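/- Let $G$ be a compact torus with Lie algebra $\mathfrak g$ and character lattice $\Lambda\subset\mathfrak g^*$, and let $X=(a_1,\dots,a_m)$ be a list (repetitions allowed) of non-zero elements of $\Lambda$ that spans the real vector space $\mathfrak g^*$. A linear subspace $\underline r\subseteq\mathfrak g^*$ is called rational (relative to $X$) if it is the linear span of the elements of $X$ lying in it. For a rational subspace $\underline r$ put $\partial_{X\setminus\underline r}=\prod_{a\in X,\ a\notin\underline r}\partial_a$ (product over the list, with multiplicity), where $\partial_a$ is the derivative in the direction $a$, acting on the space $\mathcal S'(\mathfrak g^*)$ of tempered distributions. Let $\mathcal S'(\mathfrak g^*,\underline r)\subseteq\mathcal S'(\mathfrak g^*)$ be the image of the map $j:\mathcal S'(\underline r)\to\mathcal S'(\mathfrak g^*)$, $j(\phi)(f)=\phi(f|_{\underline r})$ for Schwartz functions $f$ on $\mathfrak g^*$. Define $$\mathcal G(X)=\{f\in\mathcal S'(\mathfrak g^*)\ :\ \partial_{X\setminus\underline r}f\in\mathcal S'(\mathfrak g^*,\underline r)\ \text{for every rational subspace }\underline r\}.$$ Then the dimension of $\mathcal G(X)$ over the field of scalars ($\mathbb R$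 for real-valued, $\mathbb C$ for complex-valued distributions) is finite and equals the number of linearly independent sublists of $X$, that is, the number of subsets $S\subseteq\{1,\dots,m\}$ for which the family $(a_i)_{i\in S}$ is linearly independent over $\mathbb R$ (the empty subset included). -/

import Mathlib

open scoped SchwartzMap LineDeriv

noncomputable section

namespace SplineSpace

section Distributions

variable (𝕜 : Type*) [RCLike 𝕜] {V : Type*} [NormedAddCommGroup V] [NormedSpace ℝ V]

variable (V) in
/-- Tempered distributions on `V` with scalars in `𝕜` (real or complex): continuous `𝕜`-linear
functionals on the `𝕜`-valued Schwartz functions. For `𝕜 = ℂ` this is `𝓢'(V, ℂ)`. -/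
abbrev TDist : Type _ := 𝓢(V, 𝕜) →Lₚₜ[𝕜] 𝕜

/-- The derivative of a distribution in the direction `v`: `⟨∂_v f | g⟩ = -⟨f | ∂_v g⟩`. -/
def dirDeriv (v : V) : Module.End 𝕜 (TDist 𝕜 V) :=
  (PointwiseConvergenceCLM.precomp 𝕜
    (-LineDeriv.lineDerivOpCLM 𝕜 𝓢(V, 𝕜) v)).toLinearMap

theorem dirDeriv_apply (v : V) (f : TDist 𝕜 V) (g : 𝓢(V, 𝕜)) :
    dirDeriv 𝕜 v f g = f (-∂_{v} g) := rfl

theorem lineDerivOp_comm (v w : V) (g : 𝓢(V, 𝕜)) : ∂_{v} (∂_{w} g) = ∂_{w} (∂_{v} g) := by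
  ext x
  have key : ∀ a b : V, (∂_{a} (∂_{b} g)) x = fderiv ℝ (fderiv ℝ g) x a b := by
    intro a b
    have hd : DifferentiableAt ℝ (fderiv ℝ g) x :=
      ((g.smooth 2).fderiv_right (m := 1) (by norm_num)).differentiable (by norm_num) x
    have hb : (fun y => (∂_{b} g) y) = fun y => fderiv ℝ g y b := by
      funext y
      exact SchwartzMap.lineDerivOp_apply_eq_fderiv b g y
    rw [SchwartzMap.lineDerivOp_apply_eq_fderiv]
    change fderiv ℝ (fun y => (∂_{b} g) y) x a = _
    rw [hb, fderiv_clm_apply hd (differentiableAt_const b)]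
    simp
  rw [key, key]
  exact (g.smooth 2).contDiffAt.isSymmSndFDerivAt (by simp) v w

theorem dirDeriv_commute (v w : V) : Commute (dirDeriv 𝕜 v) (dirDeriv 𝕜 w) := by
  refine LinearMap.ext fun f => ?_
  ext g
  change f (-∂_{w} (-∂_{v} g)) = f (-∂_{v} (-∂_{w} g))
  rw [LineDeriv.lineDerivOp_neg, LineDeriv.lineDerivOp_neg, lineDerivOp_comm]

/-- Restriction of Schwartz functions to a vector subspace. -/
def restrict (r : Submodule ℝ V) : 𝓢(V, 𝕜) →L[𝕜] 𝓢(r, 𝕜) :=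
  SchwartzMap.compCLMOfAntilipschitz 𝕜 (g := r.subtypeL) (K := 1)
    r.subtypeL.hasTemperateGrowth
    (AddMonoidHomClass.antilipschitz_of_bound r.subtypeL fun x => by simp)

theorem restrict_apply (r : Submodule ℝ V) (g : 𝓢(V, 𝕜)) (x : r) : restrict 𝕜 r g x = g x := rfl

/-- The map `j` that extends a tempered distribution `φ` on the subspace `r` to `V` by
`⟨j φ | g⟩ = ⟨φ | g restricted to r⟩`. -/
def extend (r : Submodule ℝ V) : TDist 𝕜 r →ₗ[𝕜] TDist 𝕜 V :=
  (PointwiseConvergenceCLM.precomp 𝕜 (restrict 𝕜 r)).toLinearMap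

theorem extend_apply (r : Submodule ℝ V) (φ : TDist 𝕜 r) (g : 𝓢(V, 𝕜)) :
    extend 𝕜 r φ g = φ (restrict 𝕜 r g) := rfl

end Distributions

section Lists

variable {V : Type*} [NormedAddCommGroup V] [NormedSpace ℝ V] {ι : Type*}

/-- A subspace is rational relative to the list `X` if it is spanned by the elements of `X`
lying in it. -/
def IsRational (X : ι → V) (r : Submodule ℝ V) : Prop :=
  r = Submodule.span ℝ (Set.range X ∩ r)

variable (𝕜 : Type*) [RCLike 𝕜] [Fintype ι]

open scoped Classical in
/-- The operator `∂_{X ∖ r}`: the product of the (commuting) derivatives `∂_a`, where `a` runs over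
the elements of the list `X`, with multiplicity, that do not lie in `r`. -/
def derivOutside (X : ι → V) (r : Submodule ℝ V) : Module.End 𝕜 (TDist 𝕜 V) :=
  (Finset.univ.filter fun i => X i ∉ r).noncommProd (fun i => dirDeriv 𝕜 (X i))
    fun i _ j _ _ => dirDeriv_commute 𝕜 (X i) (X j)

/-- The space `𝒢(X)` of those tempered distributions `f` on `V` for which `∂_{X ∖ r} f` comes from
a tempered distribution on `r`, for every rational subspace `r`. -/
def G (X : ι → V) : Submodule 𝕜 (TDist 𝕜 V) :=
  ⨅ (r : Submodule ℝ V) (_ : IsRational X r),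
    (LinearMap.range (extend 𝕜 r)).comap (derivOutside 𝕜 X r)

theorem mem_G (X : ι → V) (f : TDist 𝕜 V) :
    f ∈ G 𝕜 X ↔ ∀ r : Submodule ℝ V, IsRational X r →
      ∃ φ : TDist 𝕜 r, extend 𝕜 r φ = derivOutside 𝕜 X r f := by
  simp [G, Submodule.mem_iInf]

end Lists

end SplineSpace

end

/-! For a rational subspace r let D(r) be the Dahmen-Micchelli space of X ∩ r: the distributions
living on r that ∂_{(X ∩ r) ∖ t} kills for every subspace t < r. The theorem follows from 𝒢(X) ≅ ⨁
D(r) over rational r, together with dim D(r) = number of bases of r contained in X, since an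
independent sublist is a basis of exactly one rational subspace, its span.

Decomposition (`nonempty_linearEquiv`). Take ℓ vanishing on r and non-zero on every a ∉ r.
Integrating test functions along rays shows that ∂_a is bijective on the distributions carried by
the half-space -1 < ℓ whenever ℓ a ≠ 0 (`exists_dirDeriv_eq`, `eq_zero_of_dirDeriv_eq_zero`). So
each p ∈ D(r) is ∂_{X ∖ r} f for a unique one-sided f; this f lies in 𝒢(X), and ∂_{X ∖ s} f = 0
unless r ≤ s (`exists_oneSided`). By this triangularity the components of an element of 𝒢(X) are
recovered by induction on the dimension of r.

Upper bound (`rank_dahmenMicchelliMod_le`). Deletion and contraction: ∂_a maps the space of a list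
to that of the list without a, and its kernel lies in the space of the list modulo a. Bases are
counted by the same recursion. It ends with the translation-invariant distributions on r, a space of
dimension at most one (`exists_forall_eq_zero_of_invariant`).

Lower bound (`card_le_finrank_dahmenMicchelli`). Replace ∂_a by ∂_a - ν_a with suitable constants.
Each basis B of r yields a linear form ξ_B with ξ_B(a) = ν_a on B, so the exponential of ξ_B solves
the perturbed equations. The initial forms (lowest homogeneous parts) of linear combinations of
these distinct exponentials solve the original equations, and they span at least as many dimensions
as there are exponentials. Only the terms ξ^k / k! enter, as densities on r. -/

namespace SplineSpace

open MeasureTheory Set Filter Topology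

/-! ### Integrals of Schwartz functions along rays. -/

section RayIntegral

variable {V : Type*} [NormedAddCommGroup V] [NormedSpace ℝ V]
  {E : Type*} [NormedAddCommGroup E] [NormedSpace ℝ E]

/-- The integral of `g` along the ray that starts in `x` and has direction `a`. -/
noncomputable def rayIntegral (a : V) (g : V → E) (x : V) : E :=
  ∫ t in Ioi (0 : ℝ), g (x + t • a)

theorem integrableOn_inv_one_add_sq :
    IntegrableOn (fun t : ℝ => ((1 + t) ^ 2)⁻¹) (Ioi 0) := by
  refine (integrableOn_add_rpow_Ioi_of_lt (a := -2) (c := 0) (m := 1) (by norm_num)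
    (by norm_num)).congr_fun (fun t ht => ?_) measurableSet_Ioi
  have ht : 0 < t := ht
  simp only
  rw [Real.rpow_neg (by positivity), add_comm t 1]
  norm_cast

/-- Since t = ℓ (x + t • a) - ℓ x, decay in the end point x + t • a becomes decay in t, at the price
of a power of 1 + ‖x‖. That price is harmless for differentiating under the integral, but not for
Schwartz bounds. -/
theorem one_add_le_of_ray {ℓ : V →L[ℝ] ℝ} {a : V} (ha : ℓ a = 1) (x : V) (t : ℝ) :
    1 + t ≤ (1 + ‖ℓ‖) * (1 + ‖x‖) * (1 + ‖x + t • a‖) := by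
  have h1 : t = ℓ (x + t • a) - ℓ x := by simp [ha]
  have h2 := ℓ.le_opNorm (x + t • a)
  have h3 := ℓ.le_opNorm x
  rw [Real.norm_eq_abs] at h2 h3
  have h4 := le_abs_self (ℓ (x + t • a))
  have h5 := neg_abs_le (ℓ x)
  have p1 := norm_nonneg ℓ
  have p2 := norm_nonneg x
  have p3 := norm_nonneg (x + t • a)
  have p4 := mul_nonneg p2 p3
  have p5 := mul_nonneg p1 p4
  nlinarith

theorem exists_bound_iteratedFDeriv_ray {ℓ : V →L[ℝ] ℝ} {a : V} (ha : ℓ a = 1) (g : 𝓢(V, E))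
    (n : ℕ) : ∃ C, 0 ≤ C ∧ ∀ (x : V) (t : ℝ), 0 ≤ t →
      ‖iteratedFDeriv ℝ n g (x + t • a)‖ ≤ C * (1 + ‖x‖) ^ 2 * ((1 + t) ^ 2)⁻¹ := by
  set S := 2 ^ 2 * ((Finset.Iic (2, n)).sup fun m => SchwartzMap.seminorm ℝ m.1 m.2) g with hS
  have hS0 : 0 ≤ S := by positivity
  refine ⟨(1 + ‖ℓ‖) ^ 2 * S, by positivity, fun x t ht => ?_⟩
  have h1 := SchwartzMap.one_add_le_sup_seminorm_apply (𝕜 := ℝ) (m := (2, n)) (k := 2) (n := n)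
    le_rfl le_rfl g (x + t • a)
  rw [← hS] at h1
  have h2 := one_add_le_of_ray ha x t
  have h3 : (1 + t) ^ 2 ≤ ((1 + ‖ℓ‖) * (1 + ‖x‖) * (1 + ‖x + t • a‖)) ^ 2 := by gcongr
  rw [← div_eq_mul_inv, le_div_iff₀ (by positivity)]
  calc ‖iteratedFDeriv ℝ n g (x + t • a)‖ * (1 + t) ^ 2
      ≤ ‖iteratedFDeriv ℝ n g (x + t • a)‖ *
        ((1 + ‖ℓ‖) * (1 + ‖x‖) * (1 + ‖x + t • a‖)) ^ 2 := by gcongr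
    _ = (1 + ‖ℓ‖) ^ 2 * (1 + ‖x‖) ^ 2 *
        ((1 + ‖x + t • a‖) ^ 2 * ‖iteratedFDeriv ℝ n g (x + t • a)‖) := by ring
    _ ≤ (1 + ‖ℓ‖) ^ 2 * (1 + ‖x‖) ^ 2 * S := by gcongr
    _ = _ := by ring

theorem continuous_iteratedFDeriv_ray (g : 𝓢(V, E)) (n : ℕ) (a x : V) :
    Continuous fun t : ℝ => iteratedFDeriv ℝ n g (x + t • a) :=
  ((g.smooth n).continuous_iteratedFDeriv (m := n) le_rfl).comp (by fun_prop)

theorem integrableOn_iteratedFDeriv_ray {ℓ : V →L[ℝ] ℝ} {a : V} (ha : ℓ a = 1) (g : 𝓢(V, E))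
    (n : ℕ) (x : V) :
    IntegrableOn (fun t : ℝ => iteratedFDeriv ℝ n g (x + t • a)) (Ioi 0) := by
  obtain ⟨C, -, hC⟩ := exists_bound_iteratedFDeriv_ray ha g n
  refine (integrableOn_inv_one_add_sq.const_mul (C * (1 + ‖x‖) ^ 2)).mono'
    (continuous_iteratedFDeriv_ray g n a x).aestronglyMeasurable ?_
  filter_upwards [ae_restrict_mem measurableSet_Ioi] with t ht
  exact hC x t (le_of_lt ht)

theorem integrableOn_ray {ℓ : V →L[ℝ] ℝ} {a : V} (ha : ℓ a = 1) (g : 𝓢(V, E)) (x : V) :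
    IntegrableOn (fun t : ℝ => g (x + t • a)) (Ioi 0) := by
  refine ((integrable_norm_iff ?_).1 ?_)
  · exact (g.continuous.comp (by fun_prop)).aestronglyMeasurable
  · simpa using (integrableOn_iteratedFDeriv_ray ha g 0 x).norm

theorem hasFTaylorSeriesUpTo_rayIntegral [CompleteSpace E] {ℓ : V →L[ℝ] ℝ} {a : V} (ha : ℓ a = 1)
    (g : 𝓢(V, E)) :
    HasFTaylorSeriesUpTo (⊤ : ℕ∞) (rayIntegral a g)
      fun x n => ∫ t in Ioi (0 : ℝ), iteratedFDeriv ℝ n g (x + t • a) := by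
  have hder : ∀ (m : ℕ) (x : V), HasFDerivAt
      (fun y => ∫ t in Ioi (0 : ℝ), iteratedFDeriv ℝ m g (y + t • a))
      (∫ t in Ioi (0 : ℝ), (iteratedFDeriv ℝ m.succ g (x + t • a)).curryLeft) x := by
    intro m x
    obtain ⟨C, hC0, hC⟩ := exists_bound_iteratedFDeriv_ray ha g (m + 1)
    refine hasFDerivAt_integral_of_dominated_of_fderiv_le
      -- Uniform on the unit ball around x, where 1 + ‖y‖ ≤ 2 + ‖x‖.
      (bound := fun t => C * (2 + ‖x‖) ^ 2 * ((1 + t) ^ 2)⁻¹)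
      (F' := fun y t => (iteratedFDeriv ℝ m.succ g (y + t • a)).curryLeft)
      (Metric.ball_mem_nhds x one_pos)
      (Eventually.of_forall fun y => (continuous_iteratedFDeriv_ray g m a y).aestronglyMeasurable)
      (integrableOn_iteratedFDeriv_ray ha g m x) ?_ ?_
      (integrableOn_inv_one_add_sq.const_mul _) ?_
    · exact ((continuousMultilinearCurryLeftEquiv ℝ (fun _ : Fin m.succ => V) E).continuous.comp
        (continuous_iteratedFDeriv_ray g m.succ a x)).aestronglyMeasurable
    · filter_upwards [ae_restrict_mem measurableSet_Ioi] with t ht y hy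
      rw [ContinuousMultilinearMap.curryLeft_norm]
      refine (hC y t (le_of_lt ht)).trans ?_
      have : ‖y‖ ≤ 1 + ‖x‖ := by
        have h1 : dist y x < 1 := hy
        rw [dist_eq_norm] at h1
        have := norm_sub_norm_le y x
        linarith
      have h2 : 1 + ‖y‖ ≤ 2 + ‖x‖ := by linarith
      have ht : (0 : ℝ) < t := ht
      gcongr
    · refine Eventually.of_forall fun t y _ => ?_
      have h1 : HasFDerivAt (iteratedFDeriv ℝ m g)
          (iteratedFDeriv ℝ m.succ g (y + t • a)).curryLeft (y + t • a) := by
        have h2 : DifferentiableAt ℝ (iteratedFDeriv ℝ m g) (y + t • a) :=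
          ((g.smooth ⊤).differentiable_iteratedFDeriv (m := m)
            (by exact_mod_cast ENat.natCast_lt_top m)) _
        have h3 := h2.hasFDerivAt
        rw [fderiv_iteratedFDeriv] at h3
        exact h3
      exact (hasFDerivAt_comp_add_right (t • a)).2 h1
  refine ⟨fun x => ?_, fun m _ x => ?_, fun m _ => ?_⟩
  · rw [rayIntegral, ContinuousMultilinearMap.curry0,
      ContinuousMultilinearMap.integral_apply (integrableOn_iteratedFDeriv_ray ha g 0 x)]
    simp
  · convert hder m x using 1
    exact (ContinuousLinearMap.integral_comp_comm (𝕜 := ℝ) (E := V [×m.succ]→L[ℝ] E)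
      (Fₗ := V →L[ℝ] V [×m]→L[ℝ] E)
      ((continuousMultilinearCurryLeftEquiv ℝ (fun _ : Fin m.succ => V) E).toContinuousLinearEquiv :
        (V [×m.succ]→L[ℝ] E) →L[ℝ] V →L[ℝ] V [×m]→L[ℝ] E)
      (integrableOn_iteratedFDeriv_ray ha g m.succ x)).symm
  · exact continuous_iff_continuousAt.2 fun x => (hder m x).continuousAt

theorem contDiff_rayIntegral [CompleteSpace E] {ℓ : V →L[ℝ] ℝ} {a : V} (ha : ℓ a = 1)
    (g : 𝓢(V, E)) : ContDiff ℝ (⊤ : ℕ∞) (rayIntegral a g) :=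
  (hasFTaylorSeriesUpTo_rayIntegral ha g).contDiff

theorem iteratedFDeriv_rayIntegral [CompleteSpace E] {ℓ : V →L[ℝ] ℝ} {a : V} (ha : ℓ a = 1)
    (g : 𝓢(V, E)) (n : ℕ) (x : V) :
    iteratedFDeriv ℝ n (rayIntegral a g) x =
      ∫ t in Ioi (0 : ℝ), iteratedFDeriv ℝ n g (x + t • a) :=
  ((hasFTaylorSeriesUpTo_rayIntegral ha g).eq_iteratedFDeriv
    (by exact_mod_cast le_top) x).symm

/-- On a half-space, rays that point into it are controlled by their moving end point. -/
theorem weight_le_of_ray {ℓ : V →L[ℝ] ℝ} {a : V} (ha : ℓ a = 1) {x : V} (hx : -2 ≤ ℓ x)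
    {t : ℝ} (ht : 0 ≤ t) :
    1 + ‖x‖ ≤ 3 * (1 + ‖ℓ‖) * (1 + ‖a‖) * (1 + ‖x + t • a‖) ∧
      1 + t ≤ 3 * (1 + ‖ℓ‖) * (1 + ‖a‖) * (1 + ‖x + t • a‖) := by
  have h1 : t ≤ ‖ℓ‖ * ‖x + t • a‖ + 2 := by
    have h1 : t = ℓ (x + t • a) - ℓ x := by simp [ha]
    have h2 := ℓ.le_opNorm (x + t • a)
    rw [Real.norm_eq_abs] at h2
    have h4 := le_abs_self (ℓ (x + t • a))
    linarith
  have h2 : ‖x‖ ≤ ‖x + t • a‖ + t * ‖a‖ := by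
    have : x = (x + t • a) - t • a := by abel
    calc ‖x‖ = ‖(x + t • a) - t • a‖ := by rw [← this]
      _ ≤ ‖x + t • a‖ + ‖t • a‖ := norm_sub_le _ _
      _ = _ := by rw [norm_smul, Real.norm_of_nonneg ht]
  have p1 := norm_nonneg ℓ
  have p2 := norm_nonneg a
  have p3 := norm_nonneg (x + t • a)
  have p4 := mul_nonneg p1 p2
  have p5 := mul_nonneg p1 p3
  have p6 := mul_nonneg p2 p3
  have p7 := mul_nonneg p4 p3
  have h3 : t * ‖a‖ ≤ (‖ℓ‖ * ‖x + t • a‖ + 2) * ‖a‖ := by gcongr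
  constructor <;> nlinarith

/-- Where -2 ≤ ℓ x, the end point controls both x and t. Of the k + 2 powers of decay, k pay for the
weight in x and two make the integral over t converge. -/
theorem exists_bound_rayIntegral (𝕜 : Type*) [NormedField 𝕜] [NormedSpace 𝕜 E]
    [SMulCommClass ℝ 𝕜 E] [CompleteSpace E] {ℓ : V →L[ℝ] ℝ} {a : V} (ha : ℓ a = 1)
    (k n : ℕ) :
    ∃ C, 0 ≤ C ∧ ∀ j ≤ n, ∀ (g : 𝓢(V, E)) (x : V), -2 ≤ ℓ x →
      (1 + ‖x‖) ^ k * ‖iteratedFDeriv ℝ j (rayIntegral a g) x‖ ≤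
        C * ((Finset.Iic (k + 2, n)).sup fun m => SchwartzMap.seminorm 𝕜 m.1 m.2) g := by
  set K := 3 * (1 + ‖ℓ‖) * (1 + ‖a‖) with hK
  have hK0 : 0 ≤ K := by positivity
  set J := ∫ t in Ioi (0 : ℝ), ((1 + t) ^ 2)⁻¹ with hJ
  have hJ0 : 0 ≤ J := integral_nonneg fun t => by positivity
  refine ⟨K ^ (k + 2) * 2 ^ (k + 2) * J, by positivity, fun j hj g x hx => ?_⟩
  set S := ((Finset.Iic (k + 2, n)).sup fun m => SchwartzMap.seminorm 𝕜 m.1 m.2) g with hS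
  rw [iteratedFDeriv_rayIntegral ha]
  have hb : ∀ t ∈ Ioi (0 : ℝ), (1 + ‖x‖) ^ k * ‖iteratedFDeriv ℝ j g (x + t • a)‖ ≤
      K ^ (k + 2) * (2 ^ (k + 2) * S) * ((1 + t) ^ 2)⁻¹ := by
    intro t ht
    have ht : (0 : ℝ) < t := ht
    obtain ⟨h1, h2⟩ := weight_le_of_ray ha hx ht.le
    rw [← hK] at h1 h2
    have h3 := SchwartzMap.one_add_le_sup_seminorm_apply (𝕜 := 𝕜) (m := (k + 2, n)) (k := k + 2)
      (n := j) le_rfl hj g (x + t • a)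
    rw [← div_eq_mul_inv, le_div_iff₀ (by positivity)]
    calc (1 + ‖x‖) ^ k * ‖iteratedFDeriv ℝ j g (x + t • a)‖ * (1 + t) ^ 2
        ≤ (K * (1 + ‖x + t • a‖)) ^ k * ‖iteratedFDeriv ℝ j g (x + t • a)‖ *
          (K * (1 + ‖x + t • a‖)) ^ 2 := by gcongr
      _ = K ^ (k + 2) * ((1 + ‖x + t • a‖) ^ (k + 2) *
          ‖iteratedFDeriv ℝ j g (x + t • a)‖) := by rw [mul_pow K, mul_pow K]; ring
      _ ≤ K ^ (k + 2) * (2 ^ (k + 2) * S) := by gcongr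
  calc (1 + ‖x‖) ^ k * ‖∫ t in Ioi (0 : ℝ), iteratedFDeriv ℝ j g (x + t • a)‖
      ≤ (1 + ‖x‖) ^ k * ∫ t in Ioi (0 : ℝ), ‖iteratedFDeriv ℝ j g (x + t • a)‖ := by
        gcongr; exact norm_integral_le_integral_norm _
    _ = ∫ t in Ioi (0 : ℝ), (1 + ‖x‖) ^ k * ‖iteratedFDeriv ℝ j g (x + t • a)‖ :=
        (integral_const_mul _ _).symm
    _ ≤ ∫ t in Ioi (0 : ℝ), K ^ (k + 2) * (2 ^ (k + 2) * S) * ((1 + t) ^ 2)⁻¹ :=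
        setIntegral_mono_on ((integrableOn_iteratedFDeriv_ray ha g j x).norm.const_mul _)
          (integrableOn_inv_one_add_sq.const_mul _) measurableSet_Ioi hb
    _ = K ^ (k + 2) * (2 ^ (k + 2) * S) * J := integral_const_mul _ _
    _ = K ^ (k + 2) * 2 ^ (k + 2) * J * S := by ring

theorem tendsto_ray {ℓ : V →L[ℝ] ℝ} {a : V} (ha : ℓ a = 1) (g : 𝓢(V, E)) (x : V) :
    Tendsto (fun t : ℝ => g (x + t • a)) atTop (𝓝 0) := by
  obtain ⟨C, -, hC⟩ := exists_bound_iteratedFDeriv_ray ha g 0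
  have h0 : Tendsto (fun t : ℝ => C * (1 + ‖x‖) ^ 2 * ((1 + t) ^ 2)⁻¹) atTop (𝓝 0) := by
    rw [← mul_zero (C * (1 + ‖x‖) ^ 2)]
    refine Tendsto.const_mul _ (tendsto_inv_atTop_zero.comp ?_)
    exact (tendsto_pow_atTop two_ne_zero).comp (tendsto_atTop_add_const_left _ _ tendsto_id)
  refine squeeze_zero_norm' ?_ h0
  filter_upwards [eventually_ge_atTop 0] with t ht
  simpa using hC x t ht

/-- The fundamental theorem of calculus along the ray; the boundary term at infinity vanishes. -/
theorem rayIntegral_lineDerivOp [CompleteSpace E] {ℓ : V →L[ℝ] ℝ} {a : V} (ha : ℓ a = 1)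
    (g : 𝓢(V, E)) (x : V) : rayIntegral a ⇑(∂_{a} g : 𝓢(V, E)) x = -g x := by
  have h := integral_Ioi_of_hasDerivAt_of_tendsto (f := fun t : ℝ => g (x + t • a))
    (f' := fun t : ℝ => (∂_{a} g : 𝓢(V, E)) (x + t • a)) (a := 0) (m := 0) ?_ ?_ ?_
    (tendsto_ray ha g x)
  · simpa [rayIntegral] using h
  · exact (g.continuous.comp (by fun_prop)).continuousWithinAt
  · intro t _
    rw [SchwartzMap.lineDerivOp_apply_eq_fderiv]
    have h1 : HasDerivAt (fun t : ℝ => x + t • a) a t := by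
      simpa using ((hasDerivAt_id t).smul_const a).const_add x
    exact (g.hasFDerivAt (x + t • a)).comp_hasDerivAt t h1
  · exact integrableOn_ray ha _ x

theorem hasLineDerivAt_rayIntegral [CompleteSpace E] {ℓ : V →L[ℝ] ℝ} {a : V} (ha : ℓ a = 1)
    (g : 𝓢(V, E)) (x : V) : HasLineDerivAt ℝ (rayIntegral a g) (-g x) x a := by
  have hd : DifferentiableAt ℝ (rayIntegral a g) x :=
    (contDiff_rayIntegral ha g).differentiable (by simp) x
  have h1 := hd.hasFDerivAt.hasLineDerivAt a
  convert h1 using 1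
  have h2 : fderiv ℝ (rayIntegral a g) x a =
      iteratedFDeriv ℝ 1 (rayIntegral a g) x (fun _ => a) := by
    rw [iteratedFDeriv_one_apply]
  rw [h2, iteratedFDeriv_rayIntegral ha, ← rayIntegral_lineDerivOp ha g x, rayIntegral,
    ContinuousMultilinearMap.integral_apply (integrableOn_iteratedFDeriv_ray ha g 1 x)]
  refine integral_congr_ae (Eventually.of_forall fun t => ?_)
  simp [SchwartzMap.lineDerivOp_apply_eq_fderiv, iteratedFDeriv_one_apply]

end RayIntegral

end SplineSpace

namespace SplineSpace

open MeasureTheory Set Filter Topology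

/-! ### A smooth step function. -/

section Cutoff

/-- A smooth function that vanishes up to `-2` and is equal to `1` from `-1` on. -/
noncomputable def cutoff (s : ℝ) : ℝ := Real.smoothTransition (s + 2)

theorem contDiff_cutoff : ContDiff ℝ (⊤ : ℕ∞) cutoff :=
  Real.smoothTransition.contDiff.comp (contDiff_id.add contDiff_const)

theorem cutoff_of_le {s : ℝ} (h : s ≤ -2) : cutoff s = 0 :=
  Real.smoothTransition.zero_of_nonpos (by linarith)

theorem cutoff_of_ge {s : ℝ} (h : -1 ≤ s) : cutoff s = 1 :=
  Real.smoothTransition.one_of_one_le (by linarith)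

theorem deriv_cutoff_of_gt {s : ℝ} (h : -1 < s) : deriv cutoff s = 0 := by
  have : cutoff =ᶠ[𝓝 s] fun _ => 1 := by
    filter_upwards [lt_mem_nhds h] with y hy using cutoff_of_ge hy.le
  rw [this.deriv_eq, deriv_const]

/-- The function is bounded and its derivative is supported in [-2, -1]. -/
theorem hasTemperateGrowth_cutoff : cutoff.HasTemperateGrowth := by
  refine Function.HasTemperateGrowth.of_fderiv (k := 0) (C := 1) ?_
    (contDiff_cutoff.differentiable (by simp)) fun x => ?_
  · refine HasCompactSupport.hasTemperateGrowth (HasCompactSupport.intro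
      (isCompact_Icc (a := (-2 : ℝ)) (b := -1)) fun x hx => ?_)
      (contDiff_cutoff.fderiv_right (m := (⊤ : ℕ∞)) (by simp))
    have hd : deriv cutoff x = 0 := by
      rcases lt_or_ge x (-2) with h | h
      · have : cutoff =ᶠ[𝓝 x] fun _ => 0 := by
          filter_upwards [gt_mem_nhds h] with y hy using cutoff_of_le hy.le
        rw [this.deriv_eq, deriv_const]
      · exact deriv_cutoff_of_gt (not_le.1 fun h' => hx ⟨h, h'⟩)
    ext
    simpa using hd
  · simp [cutoff, abs_of_nonneg (Real.smoothTransition.nonneg _), Real.smoothTransition.le_one]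

end Cutoff

/-! ### Continuous antiderivative operators on Schwartz space. -/

section Antiderivative

variable (𝕜 : Type*) [RCLike 𝕜] {V : Type*} [NormedAddCommGroup V] [NormedSpace ℝ V]

theorem rayIntegral_add {ℓ : V →L[ℝ] ℝ} {a : V} (ha : ℓ a = 1) (g h : 𝓢(V, 𝕜)) (x : V) :
    rayIntegral a ⇑(g + h) x = rayIntegral a g x + rayIntegral a h x :=
  integral_add (integrableOn_ray ha g x) (integrableOn_ray ha h x)

theorem rayIntegral_smul (c : 𝕜) (a : V) (g : 𝓢(V, 𝕜)) (x : V) :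
    rayIntegral a ⇑(c • g) x = c • rayIntegral a g x :=
  integral_smul c _

/-- Integration along rays, followed by multiplication with a function that is supported in the
half-space `-2 ≤ ℓ`, into which the rays point. -/
noncomputable def rayCLM {ℓ : V →L[ℝ] ℝ} {a : V} (ha : ℓ a = 1) {η : V → ℝ}
    (hη : η.HasTemperateGrowth) (hsupp : ∀ x, ℓ x < -2 → η x = 0) : 𝓢(V, 𝕜) →L[𝕜] 𝓢(V, 𝕜) :=
  SchwartzMap.mkCLM (fun g x => η x • rayIntegral a g x)
    (fun g h x => by rw [rayIntegral_add 𝕜 ha, smul_add])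
    (fun c g x => by rw [rayIntegral_smul, smul_comm]; rfl)
    (fun g => hη.1.smul (contDiff_rayIntegral ha g))
    (by
      rintro ⟨k, n⟩
      obtain ⟨p, C, hC0, hC⟩ := hη.norm_iteratedFDeriv_le_uniform n
      obtain ⟨C', hC'0, hC'⟩ := exists_bound_rayIntegral (E := 𝕜) 𝕜 ha (k + p) n
      refine ⟨Finset.Iic (k + p + 2, n), ∑ i ∈ Finset.range (n + 1), (n.choose i) * (C * C'),
        by positivity, fun g x => ?_⟩
      set S := ((Finset.Iic (k + p + 2, n)).sup (schwartzSeminormFamily 𝕜 V 𝕜)) g with hS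
      -- Below -2 the product vanishes near x. Elsewhere the Leibniz rule applies: derivatives of η
      -- grow at most like the power p, which the bound with k + p in place of k absorbs.
      rcases lt_or_ge (ℓ x) (-2) with hx | hx
      · have h0 : (fun y => η y • rayIntegral a g y) =ᶠ[𝓝 x] fun _ => 0 := by
          filter_upwards [ℓ.continuous.continuousAt.eventually (gt_mem_nhds hx)] with y hy
          rw [hsupp y hy, zero_smul]
        have h1 : iteratedFDeriv ℝ n (fun y => η y • rayIntegral a g y) x = 0 := by
          rw [(Filter.EventuallyEq.iteratedFDeriv ℝ h0 n).eq_of_nhds]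
          simp
        simp only
        rw [h1, norm_zero, mul_zero]
        positivity
      · have h1 := norm_iteratedFDeriv_smul_le (N := (⊤ : ℕ∞)) hη.1 (contDiff_rayIntegral ha g) x
          (n := n) (by exact_mod_cast le_top)
        calc ‖x‖ ^ k * ‖iteratedFDeriv ℝ n (fun y => η y • rayIntegral a g y) x‖
            ≤ (1 + ‖x‖) ^ k * ∑ i ∈ Finset.range (n + 1), (n.choose i) *
              ‖iteratedFDeriv ℝ i η x‖ * ‖iteratedFDeriv ℝ (n - i) (rayIntegral a g) x‖ := by
              gcongr
              linarith
          _ = ∑ i ∈ Finset.range (n + 1), (1 + ‖x‖) ^ k * ((n.choose i) *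
              ‖iteratedFDeriv ℝ i η x‖ * ‖iteratedFDeriv ℝ (n - i) (rayIntegral a g) x‖) :=
              Finset.mul_sum _ _ _
          _ ≤ ∑ i ∈ Finset.range (n + 1), (n.choose i) * (C * C') * S := by
              refine Finset.sum_le_sum fun i hi => ?_
              have hi : i ≤ n := Nat.lt_succ_iff.1 (Finset.mem_range.1 hi)
              have h2 := hC i hi x
              have h3 := hC' (n - i) (Nat.sub_le _ _) g x hx
              calc (1 + ‖x‖) ^ k * ((n.choose i) * ‖iteratedFDeriv ℝ i η x‖ *
                    ‖iteratedFDeriv ℝ (n - i) (rayIntegral a g) x‖)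
                  ≤ (1 + ‖x‖) ^ k * ((n.choose i) * (C * (1 + ‖x‖) ^ p) *
                    ‖iteratedFDeriv ℝ (n - i) (rayIntegral a g) x‖) := by gcongr
                _ = (n.choose i) * C * ((1 + ‖x‖) ^ (k + p) *
                    ‖iteratedFDeriv ℝ (n - i) (rayIntegral a g) x‖) := by ring
                _ ≤ (n.choose i) * C * (C' * S) := by
                  exact mul_le_mul_of_nonneg_left h3 (by positivity)
                _ = _ := by ring
          _ = _ := (Finset.sum_mul _ _ _).symm)

variable {𝕜}

theorem rayCLM_apply {ℓ : V →L[ℝ] ℝ} {a : V} (ha : ℓ a = 1) {η : V → ℝ}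
    (hη : η.HasTemperateGrowth) (hsupp : ∀ x, ℓ x < -2 → η x = 0) (g : 𝓢(V, 𝕜)) (x : V) :
    rayCLM 𝕜 ha hη hsupp g x = η x • rayIntegral a g x := rfl

theorem rayCLM_lineDerivOp {ℓ : V →L[ℝ] ℝ} {a : V} (ha : ℓ a = 1) {η : V → ℝ}
    (hη : η.HasTemperateGrowth) (hsupp : ∀ x, ℓ x < -2 → η x = 0) (g : 𝓢(V, 𝕜)) (x : V) :
    rayCLM 𝕜 ha hη hsupp (∂_{a} g) x = -(η x • g x) := by
  rw [rayCLM_apply, rayIntegral_lineDerivOp ha, smul_neg]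

/-- For η = `cutoff` ∘ ℓ the first term of the Leibniz rule lives in the strip -2 ≤ ℓ ≤ -1, hence is
invisible to one-sided distributions. -/
theorem lineDerivOp_rayCLM {ℓ : V →L[ℝ] ℝ} {a : V} (ha : ℓ a = 1) {η : V → ℝ}
    (hη : η.HasTemperateGrowth) (hsupp : ∀ x, ℓ x < -2 → η x = 0) (g : 𝓢(V, 𝕜)) (x : V) :
    (∂_{a} (rayCLM 𝕜 ha hη hsupp g) : 𝓢(V, 𝕜)) x =
      fderiv ℝ η x a • rayIntegral a g x - η x • g x := by
  have h1 : HasLineDerivAt ℝ (fun y => η y • rayIntegral a g y)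
      (fderiv ℝ η x a • rayIntegral a g x - η x • g x) x a := by
    have hη' : HasLineDerivAt ℝ η (fderiv ℝ η x a) x a :=
      ((hη.1.differentiable (by simp)) x).hasFDerivAt.hasLineDerivAt a
    have h2 := HasDerivAt.smul hη' (hasLineDerivAt_rayIntegral ha g x)
    simp only [zero_smul, add_zero] at h2
    unfold HasLineDerivAt
    refine h2.congr_deriv ?_
    rw [smul_neg]; abel
  rw [SchwartzMap.lineDerivOp_apply]
  exact h1.lineDeriv

theorem fderiv_cutoff_comp (ℓ : V →L[ℝ] ℝ) (x v : V) :
    fderiv ℝ (fun y => cutoff (ℓ y)) x v = deriv cutoff (ℓ x) * ℓ v := by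
  have h : HasFDerivAt (fun y => cutoff (ℓ y)) (deriv cutoff (ℓ x) • ℓ) x :=
    ((contDiff_cutoff.differentiable (by simp)) (ℓ x)).hasDerivAt.comp_hasFDerivAt x ℓ.hasFDerivAt
  rw [h.fderiv]
  simp

theorem hasTemperateGrowth_cutoff_comp (ℓ : V →L[ℝ] ℝ) :
    (fun y => cutoff (ℓ y)).HasTemperateGrowth :=
  hasTemperateGrowth_cutoff.comp ℓ.hasTemperateGrowth

/-- Antiderivative of Schwartz functions on the half-space `-1 ≤ ℓ`. -/
noncomputable def halfSpaceCLM (𝕜 : Type*) [RCLike 𝕜] {ℓ : V →L[ℝ] ℝ} {a : V} (ha : ℓ a = 1) :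
    𝓢(V, 𝕜) →L[𝕜] 𝓢(V, 𝕜) :=
  rayCLM 𝕜 ha (hasTemperateGrowth_cutoff_comp ℓ) fun _ hx => cutoff_of_le hx.le

end Antiderivative

end SplineSpace

namespace SplineSpace

open MeasureTheory Set Filter Topology

/-! ### One-sided distributions: transverse derivatives are bijective. -/

section HalfSpace

variable (𝕜 : Type*) [RCLike 𝕜] {V : Type*} [NormedAddCommGroup V] [NormedSpace ℝ V]

theorem dirDeriv_add (v w : V) : dirDeriv 𝕜 (v + w) = dirDeriv 𝕜 v + dirDeriv 𝕜 w := by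
  refine LinearMap.ext fun f => ?_
  ext g
  change f (-∂_{v + w} g) = f (-∂_{v} g) + f (-∂_{w} g)
  rw [LineDeriv.lineDerivOp_left_add, neg_add, map_add]

theorem dirDeriv_smul (c : ℝ) (v : V) : dirDeriv 𝕜 (c • v) = (c : 𝕜) • dirDeriv 𝕜 v := by
  refine LinearMap.ext fun f => ?_
  ext g
  change f (-∂_{c • v} g) = (c : 𝕜) • f (-∂_{v} g)
  rw [LineDeriv.lineDerivOp_left_smul, ← map_smul, smul_neg]
  congr 2
  ext x
  simp [RCLike.real_smul_eq_coe_mul]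

theorem dirDeriv_zero : dirDeriv 𝕜 (0 : V) = 0 := by
  simpa using dirDeriv_smul 𝕜 0 (0 : V)

/-- The distributions that vanish on all functions that vanish on the open half-space `-1 < ℓ`. -/
def halfSpaceDist (ℓ : V →L[ℝ] ℝ) : Submodule 𝕜 (TDist 𝕜 V) where
  carrier := {f | ∀ g : 𝓢(V, 𝕜), (∀ x, -1 < ℓ x → g x = 0) → f g = 0}
  add_mem' {f f'} hf hf' g hg := by
    change f g + f' g = 0
    rw [hf g hg, hf' g hg, add_zero]
  zero_mem' _ _ := rfl
  smul_mem' c f hf g hg := by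
    change c • f g = 0
    rw [hf g hg, smul_zero]

variable {𝕜}

theorem eq_of_mem_halfSpaceDist {ℓ : V →L[ℝ] ℝ} {f : TDist 𝕜 V} (hf : f ∈ halfSpaceDist 𝕜 ℓ)
    {g h : 𝓢(V, 𝕜)} (hgh : ∀ x, -1 < ℓ x → g x = h x) : f g = f h := by
  rw [← sub_eq_zero, ← map_sub]
  exact hf _ fun x hx => sub_eq_zero.2 (hgh x hx)

theorem dirDeriv_mem_halfSpaceDist {ℓ : V →L[ℝ] ℝ} (v : V) {f : TDist 𝕜 V}
    (hf : f ∈ halfSpaceDist 𝕜 ℓ) : dirDeriv 𝕜 v f ∈ halfSpaceDist 𝕜 ℓ := by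
  intro g hg
  refine hf _ fun x hx => ?_
  have h0 : (g : V → 𝕜) =ᶠ[𝓝 x] fun _ => 0 := by
    filter_upwards [ℓ.continuous.continuousAt.eventually (lt_mem_nhds hx)] with y hy using hg y hy
  change -((∂_{v} g : 𝓢(V, 𝕜)) x) = 0
  rw [SchwartzMap.lineDerivOp_apply_eq_fderiv, Filter.EventuallyEq.fderiv_eq h0]
  simp

theorem rayIntegral_eq_zero {ℓ : V →L[ℝ] ℝ} {a : V} (ha : ℓ a = 1) {g : 𝓢(V, 𝕜)}
    (hg : ∀ x, -1 < ℓ x → g x = 0) {x : V} (hx : -1 < ℓ x) : rayIntegral a g x = 0 := by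
  rw [rayIntegral, ← integral_zero ℝ 𝕜 (μ := volume.restrict (Ioi 0))]
  refine setIntegral_congr_fun measurableSet_Ioi fun t ht => ?_
  have ht : 0 < t := ht
  refine hg _ ?_
  rw [map_add, map_smul, ha, smul_eq_mul]
  linarith

/-- The solution is f composed with the antiderivative operator: applied to -∂_a g, that operator
returns g on the half-space. The solution stays one-sided because rays starting in the half-space
never leave it. -/
theorem exists_dirDeriv_eq_of_apply_eq_one {ℓ : V →L[ℝ] ℝ} {a : V} (ha : ℓ a = 1) {f : TDist 𝕜 V}
    (hf : f ∈ halfSpaceDist 𝕜 ℓ) : ∃ h ∈ halfSpaceDist 𝕜 ℓ, dirDeriv 𝕜 a h = f := by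
  refine ⟨PointwiseConvergenceCLM.precomp 𝕜 (halfSpaceCLM 𝕜 ha) f, fun g hg => ?_, ?_⟩
  · refine hf _ fun x hx => ?_
    change cutoff (ℓ x) • rayIntegral a g x = 0
    rw [rayIntegral_eq_zero ha hg hx, smul_zero]
  · ext g
    change f (halfSpaceCLM 𝕜 ha (-∂_{a} g)) = f g
    rw [map_neg]
    refine eq_of_mem_halfSpaceDist hf fun x hx => ?_
    change -(halfSpaceCLM 𝕜 ha (∂_{a} g) x) = g x
    rw [halfSpaceCLM, rayCLM_lineDerivOp, cutoff_of_ge hx.le, one_smul, neg_neg]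

/-- On the half-space g equals -∂_a of its antiderivative, so f g is a value of ∂_a f. -/
theorem eq_zero_of_apply_eq_one {ℓ : V →L[ℝ] ℝ} {a : V} (ha : ℓ a = 1) {f : TDist 𝕜 V}
    (hf : f ∈ halfSpaceDist 𝕜 ℓ) (h0 : dirDeriv 𝕜 a f = 0) : f = 0 := by
  ext g
  have h1 : dirDeriv 𝕜 a f (halfSpaceCLM 𝕜 ha g) = 0 := by rw [h0]; rfl
  rw [dirDeriv_apply] at h1
  refine Eq.trans ?_ h1
  refine eq_of_mem_halfSpaceDist hf fun x hx => ?_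
  change g x = -((∂_{a} (halfSpaceCLM 𝕜 ha g) : 𝓢(V, 𝕜)) x)
  rw [halfSpaceCLM, lineDerivOp_rayCLM, fderiv_cutoff_comp, deriv_cutoff_of_gt hx,
    cutoff_of_ge hx.le]
  simp

theorem dirDeriv_eq_smul {ℓ : V →L[ℝ] ℝ} {a : V} (ha : ℓ a ≠ 0) :
    dirDeriv 𝕜 a = ((ℓ a : ℝ) : 𝕜) • dirDeriv 𝕜 ((ℓ a)⁻¹ • a) := by
  rw [← dirDeriv_smul, smul_smul, mul_inv_cancel₀ ha, one_smul]

theorem exists_dirDeriv_eq {ℓ : V →L[ℝ] ℝ} {a : V} (ha : ℓ a ≠ 0) {f : TDist 𝕜 V}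
    (hf : f ∈ halfSpaceDist 𝕜 ℓ) : ∃ h ∈ halfSpaceDist 𝕜 ℓ, dirDeriv 𝕜 a h = f := by
  obtain ⟨h, hh, hhf⟩ := exists_dirDeriv_eq_of_apply_eq_one (a := (ℓ a)⁻¹ • a)
    (by simp [ha]) hf
  have hc : ((ℓ a : ℝ) : 𝕜) ≠ 0 := by exact_mod_cast ha
  refine ⟨((ℓ a : ℝ) : 𝕜)⁻¹ • h, Submodule.smul_mem _ _ hh, ?_⟩
  rw [map_smul, dirDeriv_eq_smul ha, LinearMap.smul_apply, hhf, smul_smul, inv_mul_cancel₀ hc,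
    one_smul]

theorem eq_zero_of_dirDeriv_eq_zero {ℓ : V →L[ℝ] ℝ} {a : V} (ha : ℓ a ≠ 0) {f : TDist 𝕜 V}
    (hf : f ∈ halfSpaceDist 𝕜 ℓ) (h0 : dirDeriv 𝕜 a f = 0) : f = 0 := by
  have hc : ((ℓ a : ℝ) : 𝕜) ≠ 0 := by exact_mod_cast ha
  refine eq_zero_of_apply_eq_one (a := (ℓ a)⁻¹ • a) (by simp [ha]) hf ?_
  rw [dirDeriv_eq_smul ha, LinearMap.smul_apply] at h0
  exact (smul_eq_zero.1 h0).resolve_left hc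

end HalfSpace

end SplineSpace

namespace SplineSpace

open MeasureTheory Set Filter Topology

/-! ### Translation-invariant distributions on a subspace. -/

section Invariant

variable {𝕜 : Type*} [RCLike 𝕜] {V : Type*} [NormedAddCommGroup V] [NormedSpace ℝ V]

theorem rayIntegral_add_rayIntegral_neg {ℓ : V →L[ℝ] ℝ} {a : V} (ha : ℓ a = 1) (g : 𝓢(V, 𝕜))
    (x : V) : rayIntegral a g x + rayIntegral (-a) g x = ∫ t : ℝ, g (x + t • a) := by
  have h1 := integrableOn_ray ha g x
  have h2 := integrableOn_ray (ℓ := -ℓ) (a := -a) (by simpa using ha) g x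
  have h3 : IntegrableOn (fun t : ℝ => g (x + t • a)) (Iio 0) := by
    refine ((Measure.measurePreserving_neg volume).integrableOn_comp_preimage
      (Homeomorph.neg ℝ).measurableEmbedding).1 ?_
    convert h2 using 1
    · funext t; simp
    · ext t; simp
  have h4 := (integrableOn_Iic_iff_integrableOn_Iio (f := fun t : ℝ => g (x + t • a))
    (by simp)).2 h3
  rw [← intervalIntegral.integral_Iic_add_Ioi h4 h1, add_comm]
  congr 1
  have h5 := integral_comp_neg_Ioi (0 : ℝ) fun t : ℝ => g (x + t • a)
  rw [neg_zero] at h5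
  rw [← h5]
  simp [rayIntegral]

/-- Modulo derivatives in the direction `a`, a function can be concentrated along `a`. -/
theorem exists_concentrated {ℓ : V →L[ℝ] ℝ} {a : V} (ha : ℓ a = 1) (g : 𝓢(V, 𝕜)) :
    ∃ g' : 𝓢(V, 𝕜), (∀ φ : TDist 𝕜 V, dirDeriv 𝕜 a φ = 0 → φ g' = φ g) ∧
      ∀ x, g' x = deriv cutoff (ℓ x) • ∫ t : ℝ, g (x + t • a) := by
  have ha' : (-ℓ) (-a) = 1 := by simpa using ha
  have hη : (fun y => 1 - cutoff (ℓ y)).HasTemperateGrowth :=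
    (Function.HasTemperateGrowth.const 1).sub (hasTemperateGrowth_cutoff_comp ℓ)
  -- The antiderivative in the opposite direction, with the complementary cutoff 1 - χ, where χ is
  -- `cutoff` ∘ ℓ.
  set B := rayCLM 𝕜 ha' hη fun x hx => by
    rw [neg_apply] at hx
    rw [cutoff_of_ge (by linarith), sub_self] with hB
  have hB' : ∀ x, (∂_{a} (B g) : 𝓢(V, 𝕜)) x =
      -(deriv cutoff (ℓ x) • rayIntegral (-a) g x) + (1 - cutoff (ℓ x)) • g x := by
    intro x
    have h1 := lineDerivOp_rayCLM ha' hη (fun x hx => by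
      rw [neg_apply] at hx
      rw [cutoff_of_ge (by linarith), sub_self]) g x
    rw [← hB, LineDeriv.lineDerivOp_left_neg] at h1
    have h2 : fderiv ℝ (fun y => 1 - cutoff (ℓ y)) x (-a) = deriv cutoff (ℓ x) := by
      rw [fderiv_const_sub, neg_apply, fderiv_cutoff_comp, map_neg, ha]
      ring
    rw [h2] at h1
    have h3 : (∂_{a} (B g) : 𝓢(V, 𝕜)) x = -((-∂_{a} (B g) : 𝓢(V, 𝕜)) x) := by simp
    rw [h3, h1]
    abel
  -- The contributions χ g and (1 - χ) g cancel g. What remains is χ' times the sum of the two ray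
  -- integrals, that is, the full line integral.
  refine ⟨g - ∂_{a} (B g - halfSpaceCLM 𝕜 ha g), fun φ hφ => ?_, fun x => ?_⟩
  · have h1 : dirDeriv 𝕜 a φ (B g - halfSpaceCLM 𝕜 ha g) = 0 := by rw [hφ]; rfl
    rw [dirDeriv_apply] at h1
    rw [sub_eq_add_neg, map_add, h1, add_zero]
  · rw [← rayIntegral_add_rayIntegral_neg ha, sub_eq_add_neg (B g),
      LineDeriv.lineDerivOp_add, LineDeriv.lineDerivOp_neg]
    change g x - ((∂_{a} (B g) : 𝓢(V, 𝕜)) x + -(∂_{a} (halfSpaceCLM 𝕜 ha g) : 𝓢(V, 𝕜)) x) = _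
    rw [hB', halfSpaceCLM, lineDerivOp_rayCLM, fderiv_cutoff_comp, ha, mul_one, smul_add, sub_smul,
      one_smul]
    abel

/-- Integrating over the directions b i one after another: as ℓ i kills the other b j, each
integration leaves the weights already produced untouched, and the cofactor I becomes invariant in
one more direction. -/
theorem exists_concentrated_finset {ι : Type*} [DecidableEq ι] {b : ι → V} {ℓ : ι → V →L[ℝ] ℝ}
    (hb : ∀ i, ℓ i (b i) = 1) (hb' : ∀ i j, i ≠ j → ℓ i (b j) = 0) (g : 𝓢(V, 𝕜)) (s : Finset ι) :
    ∃ g' : 𝓢(V, 𝕜), (∀ φ : TDist 𝕜 V, (∀ i, dirDeriv 𝕜 (b i) φ = 0) → φ g' = φ g) ∧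
      ∃ I : V → 𝕜, (∀ x, g' x = (∏ i ∈ s, deriv cutoff (ℓ i x)) • I x) ∧
        ∀ i ∈ s, ∀ (t : ℝ) (x : V), I (x + t • b i) = I x := by
  induction s using Finset.induction_on with
  | empty => exact ⟨g, fun _ _ => rfl, g, by simp, by simp⟩
  | insert i s hi ih =>
    obtain ⟨g₁, hg₁, I, hI, hinv⟩ := ih
    obtain ⟨g₂, hg₂, h₂⟩ := exists_concentrated (hb i) g₁
    refine ⟨g₂, fun φ hφ => (hg₂ φ (hφ _)).trans (hg₁ φ hφ),
      fun x => ∫ t : ℝ, I (x + t • b i), fun x => ?_, fun j hj t x => ?_⟩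
    · rw [h₂, Finset.prod_insert hi, mul_smul]
      congr 1
      rw [← integral_smul]
      refine integral_congr_ae (Eventually.of_forall fun t => ?_)
      simp only [hI]
      congr 1
      refine Finset.prod_congr rfl fun j hj => ?_
      have hij : j ≠ i := fun h => hi (h ▸ hj)
      simp [hb' j i hij]
    · rcases Finset.mem_insert.1 hj with rfl | hj
      · simp only [add_assoc, ← add_smul]
        exact integral_add_left_eq_self (fun u : ℝ => I (x + u • b j)) t
      · simp only [add_right_comm x (t • b j), hinv j hj]

/-- Distributions on a subspace `r` all of whose derivatives along `r` vanish are determined by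
one value. -/
theorem exists_forall_eq_zero_of_invariant (𝕜 : Type*) [RCLike 𝕜] [FiniteDimensional ℝ V]
    (r : Submodule ℝ V) :
    ∃ G : 𝓢(V, 𝕜), ∀ φ : TDist 𝕜 V, (∀ v ∈ r, dirDeriv 𝕜 v φ = 0) →
      (∀ g : 𝓢(V, 𝕜), (∀ x ∈ r, g x = 0) → φ g = 0) → φ G = 0 → φ = 0 := by
  classical
  set b := Module.finBasis ℝ r with hb
  obtain ⟨p, hp⟩ := LinearMap.exists_extend (LinearMap.id : r →ₗ[ℝ] r)
  have hp' : ∀ x : r, p x = x := fun x => LinearMap.congr_fun hp x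
  set ℓ : Fin (Module.finrank ℝ r) → V →L[ℝ] ℝ := fun i =>
    ((b.coord i).comp p).toContinuousLinearMap with hℓ
  have key : ∀ g : 𝓢(V, 𝕜), ∃ (g' : 𝓢(V, 𝕜)) (c : 𝕜),
      (∀ φ : TDist 𝕜 V, (∀ v ∈ r, dirDeriv 𝕜 v φ = 0) → φ g' = φ g) ∧
        ∀ x ∈ r, g' x = (∏ i, deriv cutoff (ℓ i x)) • c := by
    intro g
    obtain ⟨g', hg', I, hI, hinv⟩ := exists_concentrated_finset (b := fun i => (b i : V)) (ℓ := ℓ)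
      (fun i => by simp [hℓ, hp'])
      (fun i j hij => by simp [hℓ, hp', Finsupp.single_eq_of_ne hij]) g Finset.univ
    refine ⟨g', I 0, fun φ hφ => hg' φ fun i => hφ _ (b i).2, fun x hx => ?_⟩
    rw [hI]
    congr 1
    have : ∀ (s : Finset _) (c : _ → ℝ), I (∑ i ∈ s, c i • (b i : V)) = I 0 := by
      intro s c
      induction s using Finset.induction_on with
      | empty => simp
      | insert i s hi ih =>
        rw [Finset.sum_insert hi, add_comm, hinv i (Finset.mem_univ i), ih]
    rw [← this Finset.univ fun i => b.repr ⟨x, hx⟩ i]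
    congr 1
    have h : ((∑ i, b.repr ⟨x, hx⟩ i • b i : r) : V) = x := by rw [b.sum_repr]
    refine h.symm.trans ?_
    rw [Submodule.coe_sum]
    rfl
  choose g' c hg' hc using key
  -- On r every g is now a multiple c g of one fixed profile, so any g₀ with c g₀ ≠ 0 determines φ.
  -- If there is no such g₀, every φ in question is zero.
  by_cases h : ∃ g, c g ≠ 0
  · obtain ⟨g₀, h₀⟩ := h
    refine ⟨g₀, fun φ hφ hr hG => ?_⟩
    ext g
    have h1 : φ (g' g - (c g / c g₀) • g' g₀) = 0 := by
      refine hr _ fun x hx => ?_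
      rw [sub_apply, smul_apply, hc _ _ hx, hc _ _ hx, smul_comm, smul_eq_mul,
        div_mul_cancel₀ _ h₀, sub_self]
    rw [map_sub, map_smul, hg' g φ hφ, hg' g₀ φ hφ, hG, smul_zero, sub_zero] at h1
    exact h1
  · push Not at h
    refine ⟨0, fun φ hφ hr _ => ?_⟩
    ext g
    rw [← hg' g φ hφ]
    refine hr _ fun x hx => ?_
    rw [hc _ _ hx, h, smul_zero]

end Invariant

end SplineSpace

namespace SplineSpace

/-! ### Products of derivatives along sublists. -/

section DerivProd

variable (𝕜 : Type*) [RCLike 𝕜] {V : Type*} [NormedAddCommGroup V] [NormedSpace ℝ V]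
  {ι : Type*} (X : ι → V)

/-- The product of the derivatives in the directions of a sublist of `X`. -/
noncomputable def derivProd (s : Finset ι) : Module.End 𝕜 (TDist 𝕜 V) :=
  s.noncommProd (fun i => dirDeriv 𝕜 (X i)) fun i _ j _ _ => dirDeriv_commute 𝕜 (X i) (X j)

@[simp]
theorem derivProd_empty : derivProd 𝕜 X ∅ = 1 := rfl

theorem derivProd_insert [DecidableEq ι] {i : ι} {s : Finset ι} (hi : i ∉ s) :
    derivProd 𝕜 X (insert i s) = dirDeriv 𝕜 (X i) * derivProd 𝕜 X s :=
  Finset.noncommProd_insert_of_notMem _ _ _ _ hi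

theorem derivProd_insert_apply [DecidableEq ι] {i : ι} {s : Finset ι} (hi : i ∉ s)
    (f : TDist 𝕜 V) :
    derivProd 𝕜 X (insert i s) f = dirDeriv 𝕜 (X i) (derivProd 𝕜 X s f) := by
  rw [derivProd_insert 𝕜 X hi]; rfl

theorem derivProd_commute_dirDeriv (s : Finset ι) (v : V) :
    Commute (derivProd 𝕜 X s) (dirDeriv 𝕜 v) := by
  classical
  induction s using Finset.induction_on with
  | empty => exact Commute.one_left _
  | insert i s hi ih =>
    rw [derivProd_insert 𝕜 X hi]
    exact (dirDeriv_commute 𝕜 _ _).mul_left ih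

theorem derivProd_dirDeriv (s : Finset ι) (v : V) (f : TDist 𝕜 V) :
    derivProd 𝕜 X s (dirDeriv 𝕜 v f) = dirDeriv 𝕜 v (derivProd 𝕜 X s f) :=
  LinearMap.congr_fun (derivProd_commute_dirDeriv 𝕜 X s v) f

theorem derivProd_derivProd_comm (s t : Finset ι) (f : TDist 𝕜 V) :
    derivProd 𝕜 X s (derivProd 𝕜 X t f) = derivProd 𝕜 X t (derivProd 𝕜 X s f) := by
  classical
  induction s using Finset.induction_on with
  | empty => rfl
  | insert i s hi ih =>
    rw [derivProd_insert_apply 𝕜 X hi, derivProd_insert_apply 𝕜 X hi, ih, derivProd_dirDeriv]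

theorem derivProd_union [DecidableEq ι] {s t : Finset ι} (h : Disjoint s t) (f : TDist 𝕜 V) :
    derivProd 𝕜 X (s ∪ t) f = derivProd 𝕜 X s (derivProd 𝕜 X t f) := by
  induction s using Finset.induction_on with
  | empty => simp
  | insert i s hi ih =>
    rw [Finset.disjoint_insert_left] at h
    rw [Finset.insert_union, derivProd_insert_apply 𝕜 X hi, ← ih h.2,
      derivProd_insert_apply 𝕜 X (by simp [hi, h.1])]

/-- A larger product of derivatives factors through a smaller one. -/
theorem derivProd_eq_sdiff [DecidableEq ι] {s t : Finset ι} (h : s ⊆ t) (f : TDist 𝕜 V) :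
    derivProd 𝕜 X t f = derivProd 𝕜 X (t \ s) (derivProd 𝕜 X s f) := by
  rw [← derivProd_union 𝕜 X Finset.sdiff_disjoint, Finset.sdiff_union_of_subset h]

theorem derivProd_eq_zero_of_subset {s t : Finset ι} (h : s ⊆ t) {f : TDist 𝕜 V}
    (h0 : derivProd 𝕜 X s f = 0) : derivProd 𝕜 X t f = 0 := by
  classical
  rw [derivProd_eq_sdiff 𝕜 X h, h0, map_zero]

variable {𝕜 X}

theorem derivProd_mem {M : Submodule 𝕜 (TDist 𝕜 V)} {s : Finset ι}
    (hM : ∀ i ∈ s, ∀ f ∈ M, dirDeriv 𝕜 (X i) f ∈ M) {f : TDist 𝕜 V} (hf : f ∈ M) :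
    derivProd 𝕜 X s f ∈ M := by
  classical
  induction s using Finset.induction_on with
  | empty => exact hf
  | insert i s hi ih =>
    rw [derivProd_insert_apply 𝕜 X hi]
    exact hM i (Finset.mem_insert_self i s) _
      (ih fun j hj => hM j (Finset.mem_insert_of_mem hj))

theorem derivProd_mem_halfSpaceDist {ℓ : V →L[ℝ] ℝ} (s : Finset ι) {f : TDist 𝕜 V}
    (hf : f ∈ halfSpaceDist 𝕜 ℓ) : derivProd 𝕜 X s f ∈ halfSpaceDist 𝕜 ℓ :=
  derivProd_mem (fun _ _ _ h => dirDeriv_mem_halfSpaceDist _ h) hf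

theorem eq_zero_of_derivProd_eq_zero {ℓ : V →L[ℝ] ℝ} {s : Finset ι} (hs : ∀ i ∈ s, ℓ (X i) ≠ 0)
    {f : TDist 𝕜 V} (hf : f ∈ halfSpaceDist 𝕜 ℓ) (h0 : derivProd 𝕜 X s f = 0) : f = 0 := by
  classical
  induction s using Finset.induction_on with
  | empty => exact h0
  | insert i s hi ih =>
    rw [derivProd_insert_apply 𝕜 X hi] at h0
    exact ih (fun j hj => hs j (Finset.mem_insert_of_mem hj)) (eq_zero_of_dirDeriv_eq_zero
      (hs i (Finset.mem_insert_self i s)) (derivProd_mem_halfSpaceDist s hf) h0)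

theorem exists_derivProd_eq {ℓ : V →L[ℝ] ℝ} {s : Finset ι} (hs : ∀ i ∈ s, ℓ (X i) ≠ 0)
    {f : TDist 𝕜 V} (hf : f ∈ halfSpaceDist 𝕜 ℓ) :
    ∃ h ∈ halfSpaceDist 𝕜 ℓ, derivProd 𝕜 X s h = f := by
  classical
  induction s using Finset.induction_on generalizing f with
  | empty => exact ⟨f, hf, rfl⟩
  | insert i s hi ih =>
    obtain ⟨h₁, hh₁, rfl⟩ := exists_dirDeriv_eq (hs i (Finset.mem_insert_self i s)) hf
    obtain ⟨h, hh, rfl⟩ := ih (fun j hj => hs j (Finset.mem_insert_of_mem hj)) hh₁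
    exact ⟨h, hh, derivProd_insert_apply 𝕜 X hi h⟩

end DerivProd

/-! ### Distributions carried by subspaces. -/

section Extend

variable {𝕜 : Type*} [RCLike 𝕜] {V : Type*} [NormedAddCommGroup V] [NormedSpace ℝ V]
  {ι : Type*} {X : ι → V}

theorem apply_eq_zero_of_mem_range_extend {r : Submodule ℝ V} {f : TDist 𝕜 V}
    (hf : f ∈ LinearMap.range (extend 𝕜 r)) {g : 𝓢(V, 𝕜)} (hg : ∀ x ∈ r, g x = 0) : f g = 0 := by
  obtain ⟨φ, rfl⟩ := hf
  have h : restrict 𝕜 r g = 0 := by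
    ext x
    exact hg x x.2
  rw [extend_apply, h, map_zero]

theorem restrict_lineDerivOp (r : Submodule ℝ V) (v : r) (g : 𝓢(V, 𝕜)) :
    restrict 𝕜 r (∂_{(v : V)} g) = ∂_{v} (restrict 𝕜 r g) := by
  ext x
  rw [restrict_apply, SchwartzMap.lineDerivOp_apply_eq_fderiv,
    SchwartzMap.lineDerivOp_apply_eq_fderiv]
  have h : HasFDerivAt (restrict 𝕜 r g) ((fderiv ℝ g (x : V)).comp r.subtypeL) x :=
    (g.hasFDerivAt (x : V)).comp x r.subtypeL.hasFDerivAt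
  rw [h.fderiv]
  rfl

theorem dirDeriv_extend (r : Submodule ℝ V) (v : r) (φ : TDist 𝕜 r) :
    dirDeriv 𝕜 (v : V) (extend 𝕜 r φ) = extend 𝕜 r (dirDeriv 𝕜 v φ) := by
  ext g
  rw [dirDeriv_apply, extend_apply, extend_apply, dirDeriv_apply, map_neg, restrict_lineDerivOp]

theorem dirDeriv_mem_range_extend {r : Submodule ℝ V} {v : V} (hv : v ∈ r) {f : TDist 𝕜 V}
    (hf : f ∈ LinearMap.range (extend 𝕜 r)) :
    dirDeriv 𝕜 v f ∈ LinearMap.range (extend 𝕜 r) := by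
  obtain ⟨φ, rfl⟩ := hf
  exact ⟨_, (dirDeriv_extend r ⟨v, hv⟩ φ).symm⟩

theorem extend_mem_halfSpaceDist {ℓ : V →L[ℝ] ℝ} {r : Submodule ℝ V} {φ : TDist 𝕜 r}
    (hφ : φ ∈ halfSpaceDist 𝕜 (ℓ.comp r.subtypeL)) : extend 𝕜 r φ ∈ halfSpaceDist 𝕜 ℓ :=
  fun g hg => hφ (restrict 𝕜 r g) fun x hx => hg x hx

/-- The kernel of ℓ lies inside the open half-space; this is why its threshold is -1 and not 0. -/
theorem range_extend_le_halfSpaceDist {ℓ : V →L[ℝ] ℝ} {r : Submodule ℝ V}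
    (hr : ∀ x ∈ r, ℓ x = 0) : LinearMap.range (extend 𝕜 r) ≤ halfSpaceDist 𝕜 ℓ :=
  fun _ hf g hg => apply_eq_zero_of_mem_range_extend hf fun x hx => hg x (by rw [hr x hx]; norm_num)

/-- Restriction of Schwartz functions from a subspace to a smaller one. -/
noncomputable def restrictOfLe (𝕜 : Type*) [RCLike 𝕜] {r s : Submodule ℝ V} (h : r ≤ s) :
    𝓢(s, 𝕜) →L[𝕜] 𝓢(r, 𝕜) :=
  SchwartzMap.compCLMOfAntilipschitz 𝕜
    (g := r.subtypeL.codRestrict s fun x => h x.2) (K := 1)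
    (ContinuousLinearMap.hasTemperateGrowth _)
    (AddMonoidHomClass.antilipschitz_of_bound _ fun x => by simp)

/-- Restriction to r factors through s, so φ may first be extended to s, where it is one-sided for ℓ
restricted to s. -/
theorem exists_extend_eq_of_le {ℓ : V →L[ℝ] ℝ} {r s : Submodule ℝ V} (h : r ≤ s)
    (hr : ∀ x ∈ r, ℓ x = 0) (φ : TDist 𝕜 r) :
    ∃ ψ ∈ halfSpaceDist 𝕜 (ℓ.comp s.subtypeL), extend 𝕜 s ψ = extend 𝕜 r φ := by
  refine ⟨PointwiseConvergenceCLM.precomp 𝕜 (restrictOfLe 𝕜 h) φ, fun g hg => ?_, rfl⟩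
  have h0 : restrictOfLe 𝕜 h g = 0 := by
    ext x
    exact hg ⟨x, h x.2⟩ (by change -1 < ℓ x; rw [hr x x.2]; norm_num)
  change φ (restrictOfLe 𝕜 h g) = 0
  rw [h0, map_zero]

/-- The half-space theory applied inside r, with ℓ restricted to r. -/
theorem exists_derivProd_extend_eq {ℓ : V →L[ℝ] ℝ} {r : Submodule ℝ V} {s : Finset ι}
    (hs : ∀ i ∈ s, X i ∈ r) (hs' : ∀ i ∈ s, ℓ (X i) ≠ 0) {φ : TDist 𝕜 r}
    (hφ : φ ∈ halfSpaceDist 𝕜 (ℓ.comp r.subtypeL)) :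
    ∃ ψ ∈ halfSpaceDist 𝕜 (ℓ.comp r.subtypeL),
      derivProd 𝕜 X s (extend 𝕜 r ψ) = extend 𝕜 r φ := by
  classical
  induction s using Finset.induction_on generalizing φ with
  | empty => exact ⟨φ, hφ, rfl⟩
  | insert i s hi ih =>
    have his := Finset.mem_insert_self i s
    obtain ⟨φ₁, hφ₁, rfl⟩ := exists_dirDeriv_eq (a := (⟨X i, hs i his⟩ : r)) (hs' i his) hφ
    obtain ⟨ψ, hψ, h⟩ := ih (fun j hj => hs j (Finset.mem_insert_of_mem hj))
      (fun j hj => hs' j (Finset.mem_insert_of_mem hj)) hφ₁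
    refine ⟨ψ, hψ, ?_⟩
    rw [derivProd_insert_apply 𝕜 X hi, h, ← dirDeriv_extend]

/-- A one-sided solution of `∂ f = p` lives on every subspace that contains the directions and
the support of `p`. -/
theorem mem_range_extend_of_derivProd_mem {ℓ : V →L[ℝ] ℝ} {r s : Submodule ℝ V} (h : r ≤ s)
    (hr : ∀ x ∈ r, ℓ x = 0) {J : Finset ι} (hJ : ∀ i ∈ J, X i ∈ s) (hJ' : ∀ i ∈ J, ℓ (X i) ≠ 0)
    {f : TDist 𝕜 V} (hf : f ∈ halfSpaceDist 𝕜 ℓ)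
    (hp : derivProd 𝕜 X J f ∈ LinearMap.range (extend 𝕜 r)) :
    f ∈ LinearMap.range (extend 𝕜 s) := by
  obtain ⟨φ, hφ⟩ := hp
  obtain ⟨ψ₀, hψ₀, h₀⟩ := exists_extend_eq_of_le h hr φ
  obtain ⟨ψ, hψ, h₁⟩ := exists_derivProd_extend_eq hJ hJ' hψ₀
  refine ⟨ψ, ?_⟩
  rw [← sub_eq_zero]
  -- Uniqueness on V identifies f with the solution constructed inside s.
  refine eq_zero_of_derivProd_eq_zero hJ'
    (Submodule.sub_mem _ (extend_mem_halfSpaceDist hψ) hf) ?_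
  rw [map_sub, h₁, h₀, hφ, sub_self]

end Extend

end SplineSpace

/-! ### Upper bound for Dahmen-Micchelli spaces by deletion and contraction. -/

namespace SplineSpace

theorem rank_le_rank_add_rank {K M : Type*} [Field K] [AddCommGroup M] [Module K M]
    {T : Module.End K M} {A B C : Submodule K M} (hB : ∀ f ∈ A, T f ∈ B)
    (hC : ∀ f ∈ A, T f = 0 → f ∈ C) : Module.rank K A ≤ Module.rank K B + Module.rank K C := by
  have hker : Module.rank K (LinearMap.ker (T.restrict hB)) ≤ Module.rank K C := by
    refine LinearMap.rank_le_of_injective ((A.subtype.comp (Submodule.subtype _)).codRestrict C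
      fun f => hC _ f.1.2 (congr_arg Subtype.val f.2)) fun f g h => ?_
    have h' : (f.1.1 : M) = g.1.1 := congr_arg (fun x : C => (x : M)) h
    exact Subtype.ext (Subtype.ext h')
  rw [← LinearMap.rank_range_add_rank_ker (T.restrict hB)]
  exact add_le_add (Submodule.rank_le _) hker

section UpperBound

variable (𝕜 : Type*) [RCLike 𝕜] {V : Type*} [NormedAddCommGroup V] [NormedSpace ℝ V]
  {ι : Type*} (X : ι → V)

open scoped Classical in
/-- The distributions on `r` that are invariant under `U` and satisfy the Dahmen-Micchelli equations
of the list `X i`, `i ∈ s`, modulo `U`. -/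
noncomputable def dahmenMicchelliMod (r U : Submodule ℝ V) (s : Finset ι) :
    Submodule 𝕜 (TDist 𝕜 V) :=
  LinearMap.range (extend 𝕜 r) ⊓ (⨅ u ∈ U, LinearMap.ker (dirDeriv 𝕜 u)) ⊓
    ⨅ (t : Submodule ℝ V) (_ : U ≤ t) (_ : t < r),
      LinearMap.ker (derivProd 𝕜 X (s.filter fun i => X i ∉ t))

variable {𝕜 X}

open scoped Classical in
theorem mem_dahmenMicchelliMod {r U : Submodule ℝ V} {s : Finset ι} {f : TDist 𝕜 V} :
    f ∈ dahmenMicchelliMod 𝕜 X r U s ↔ f ∈ LinearMap.range (extend 𝕜 r) ∧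
      (∀ u ∈ U, dirDeriv 𝕜 u f = 0) ∧ ∀ t : Submodule ℝ V, U ≤ t → t < r →
        derivProd 𝕜 X (s.filter fun i => X i ∉ t) f = 0 := by
  simp only [dahmenMicchelliMod, Submodule.mem_inf, Submodule.mem_iInf, LinearMap.mem_ker,
    and_assoc]

/-- `S` is a basis of `r` modulo `U`. -/
def IsBasisMod (X : ι → V) (r U : Submodule ℝ V) (S : Finset ι) : Prop :=
  U ⊔ Submodule.span ℝ (X '' S) = r ∧ S.card + Module.finrank ℝ U = Module.finrank ℝ r

theorem IsBasisMod.insert [FiniteDimensional ℝ V] [DecidableEq ι] {r U : Submodule ℝ V} {i : ι}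
    {S : Finset ι} (hi : i ∉ S) (hU : X i ∉ U)
    (h : IsBasisMod X r (U ⊔ Submodule.span ℝ {X i}) S) : IsBasisMod X r U (insert i S) := by
  obtain ⟨h1, h2⟩ := h
  refine ⟨?_, ?_⟩
  · rw [Finset.coe_insert, Set.image_insert_eq, Submodule.span_insert, ← sup_assoc, h1]
  · have h3 := Submodule.finrank_sup_add_finrank_inf_eq U (Submodule.span ℝ {X i})
    have h0 : X i ≠ 0 := fun h => hU (h ▸ U.zero_mem)
    have h4 : U ⊓ Submodule.span ℝ {X i} = ⊥ :=
      ((Submodule.disjoint_span_singleton' h0).2 hU).eq_bot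
    rw [h4, finrank_bot, finrank_span_singleton h0] at h3
    rw [Finset.card_insert_of_notMem hi]
    omega

open scoped Classical in
-- Bases modulo U that avoid i, and those obtained by adding i to a basis modulo U and X i, are
-- disjoint families.
theorem card_isBasisMod_insert [FiniteDimensional ℝ V] {r U : Submodule ℝ V} {i : ι}
    {s : Finset ι} (hi : i ∉ s) (hU : X i ∉ U) :
    (s.powerset.filter (IsBasisMod X r U)).card +
      (s.powerset.filter (IsBasisMod X r (U ⊔ Submodule.span ℝ {X i}))).card ≤
      ((insert i s).powerset.filter (IsBasisMod X r U)).card := by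
  have hnot : ∀ S ∈ s.powerset, i ∉ S := fun S hS h => hi (Finset.mem_powerset.1 hS h)
  rw [← Finset.card_image_of_injOn (f := insert i)
    (s := s.powerset.filter (IsBasisMod X r (U ⊔ Submodule.span ℝ {X i}))),
    ← Finset.card_union_of_disjoint]
  · refine Finset.card_le_card fun S hS => ?_
    rw [Finset.mem_filter, Finset.mem_powerset]
    rcases Finset.mem_union.1 hS with hS | hS
    · obtain ⟨h1, h2⟩ := Finset.mem_filter.1 hS
      exact ⟨(Finset.mem_powerset.1 h1).trans (Finset.subset_insert i s), h2⟩
    · obtain ⟨T, hT, rfl⟩ := Finset.mem_image.1 hS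
      obtain ⟨h1, h2⟩ := Finset.mem_filter.1 hT
      exact ⟨Finset.insert_subset_insert i (Finset.mem_powerset.1 h1), h2.insert (hnot T h1) hU⟩
  · rw [Finset.disjoint_left]
    intro S hS hS'
    obtain ⟨T, -, rfl⟩ := Finset.mem_image.1 hS'
    exact hnot _ (Finset.mem_filter.1 hS).1 (Finset.mem_insert_self i T)
  · intro S hS T hT h
    have h1 := hnot S (Finset.mem_filter.1 hS).1
    have h2 := hnot T (Finset.mem_filter.1 hT).1
    simpa [Finset.erase_insert h1, Finset.erase_insert h2] using congr_arg (Finset.erase · i) h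

/-- For U = r no t satisfies r ≤ t < r, so only invariance along r remains. -/
theorem rank_invariant_le_one [FiniteDimensional ℝ V] (r : Submodule ℝ V) (s : Finset ι) :
    Module.rank 𝕜 (dahmenMicchelliMod 𝕜 X r r s) ≤ 1 := by
  obtain ⟨G, hG⟩ := exists_forall_eq_zero_of_invariant 𝕜 r
  set T : TDist 𝕜 V →ₗ[𝕜] 𝕜 :=
    { toFun := fun f => f G, map_add' := fun _ _ => rfl, map_smul' := fun _ _ => rfl } with hT
  have hinj : Function.Injective (T.domRestrict (dahmenMicchelliMod 𝕜 X r r s)) := by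
    rw [← LinearMap.ker_eq_bot, LinearMap.ker_eq_bot']
    rintro ⟨f, hf⟩ h0
    rw [mem_dahmenMicchelliMod] at hf
    exact Subtype.ext (hG f hf.2.1 (fun g hg => apply_eq_zero_of_mem_range_extend hf.1 hg) h0)
  have h := LinearMap.lift_rank_le_of_injective _ hinj
  rw [Module.rank_self, Cardinal.lift_one, Cardinal.lift_le_one_iff] at h
  exact h

/-- Deletion: if X i ∉ t, the new derivative supplies the missing factor; if X i ∈ t, the equation
does not involve i. -/
theorem dirDeriv_mem_dahmenMicchelliMod {r U : Submodule ℝ V} {i : ι} {s : Finset ι}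
    [DecidableEq ι] (hi : i ∉ s) (hr : X i ∈ r) {f : TDist 𝕜 V}
    (hf : f ∈ dahmenMicchelliMod 𝕜 X r U (insert i s)) :
    dirDeriv 𝕜 (X i) f ∈ dahmenMicchelliMod 𝕜 X r U s := by
  classical
  rw [mem_dahmenMicchelliMod] at hf ⊢
  obtain ⟨h1, h2, h3⟩ := hf
  refine ⟨dirDeriv_mem_range_extend hr h1, fun u hu => ?_, fun t hUt htr => ?_⟩
  · have h := LinearMap.congr_fun (dirDeriv_commute 𝕜 u (X i)) f
    change dirDeriv 𝕜 u (dirDeriv 𝕜 (X i) f) = dirDeriv 𝕜 (X i) (dirDeriv 𝕜 u f) at h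
    rw [h, h2 u hu, map_zero]
  · have h := h3 t hUt htr
    rw [derivProd_dirDeriv]
    rw [Finset.filter_insert] at h
    split_ifs at h with hit
    · rw [h, map_zero]
    · rwa [derivProd_insert_apply 𝕜 X (by simp [hi])] at h

/-- Contraction: f becomes invariant along X i, and subspaces t containing X i give equations
without the factor i. -/
theorem mem_dahmenMicchelliMod_sup {r U : Submodule ℝ V} {i : ι} {s : Finset ι}
    [DecidableEq ι] {f : TDist 𝕜 V} (hf : f ∈ dahmenMicchelliMod 𝕜 X r U (insert i s))
    (h0 : dirDeriv 𝕜 (X i) f = 0) :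
    f ∈ dahmenMicchelliMod 𝕜 X r (U ⊔ Submodule.span ℝ {X i}) s := by
  classical
  rw [mem_dahmenMicchelliMod] at hf ⊢
  obtain ⟨h1, h2, h3⟩ := hf
  refine ⟨h1, fun u hu => ?_, fun t hUt htr => ?_⟩
  · obtain ⟨y, hy, z, hz, rfl⟩ := Submodule.mem_sup.1 hu
    obtain ⟨c, rfl⟩ := Submodule.mem_span_singleton.1 hz
    rw [dirDeriv_add, dirDeriv_smul, LinearMap.add_apply, LinearMap.smul_apply, h0, h2 y hy,
      smul_zero, add_zero]
  · have hit : X i ∈ t := hUt (Submodule.mem_sup_right (Submodule.mem_span_singleton_self _))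
    have h := h3 t (le_sup_left.trans hUt) htr
    rwa [Finset.filter_insert, if_neg (not_not.2 hit)] at h

open scoped Classical in
-- Induction on the list. For the empty list either U = r, with ∅ as a basis, or the equation for t
-- = U is the empty product and reads f = 0. A vector in U only drops out; any other vector gives
-- the deletion-contraction inequality.
theorem rank_dahmenMicchelliMod_le [FiniteDimensional ℝ V] {r : Submodule ℝ V} {s : Finset ι}
    (hs : ∀ i ∈ s, X i ∈ r) {U : Submodule ℝ V} (hU : U ≤ r) :
    Module.rank 𝕜 (dahmenMicchelliMod 𝕜 X r U s) ≤
      ((s.powerset.filter (IsBasisMod X r U)).card : Cardinal) := by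
  induction s using Finset.induction_on generalizing U with
  | empty =>
    rcases hU.eq_or_lt with rfl | hlt
    · refine (rank_invariant_le_one U ∅).trans ?_
      have : IsBasisMod X U U ∅ := by simp [IsBasisMod]
      rw [Finset.powerset_empty, Finset.filter_singleton, if_pos this]
      simp
    · have : dahmenMicchelliMod 𝕜 X r U ∅ = ⊥ := by
        rw [eq_bot_iff]
        intro f hf
        rw [mem_dahmenMicchelliMod] at hf
        simpa using hf.2.2 U le_rfl hlt
      rw [this, rank_bot]
      exact zero_le
  | insert i s hi ih =>
    have hs' : ∀ j ∈ s, X j ∈ r := fun j hj => hs j (Finset.mem_insert_of_mem hj)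
    have hir : X i ∈ r := hs i (Finset.mem_insert_self i s)
    by_cases hiU : X i ∈ U
    · have hle : dahmenMicchelliMod 𝕜 X r U (insert i s) ≤ dahmenMicchelliMod 𝕜 X r U s := by
        intro f hf
        have h := mem_dahmenMicchelliMod_sup hf ((mem_dahmenMicchelliMod.1 hf).2.1 _ hiU)
        rwa [sup_eq_left.2 ((Submodule.span_singleton_le_iff_mem _ _).2 hiU)] at h
      refine (Submodule.rank_mono hle).trans ((ih hs' hU).trans ?_)
      exact_mod_cast Finset.card_le_card (Finset.filter_subset_filter _
        (Finset.powerset_mono.2 (Finset.subset_insert i s)))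
    · refine (rank_le_rank_add_rank (C := dahmenMicchelliMod 𝕜 X r (U ⊔ Submodule.span ℝ {X i}) s)
        (fun f hf => dirDeriv_mem_dahmenMicchelliMod hi hir hf)
        (fun f hf h0 => mem_dahmenMicchelliMod_sup hf h0)).trans ((add_le_add (ih hs' hU)
        (ih hs' (sup_le hU ((Submodule.span_singleton_le_iff_mem _ _).2 hir)))).trans ?_)
      exact_mod_cast card_isBasisMod_insert hi hiU

end UpperBound

end SplineSpace

namespace SplineSpace

/-! ### Decomposition of 𝒢(X) over the rational subspaces. -/

section Decomposition

variable (𝕜 : Type*) [RCLike 𝕜] {V : Type*} [NormedAddCommGroup V] [NormedSpace ℝ V]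
  {ι : Type*} [Fintype ι] (X : ι → V)

open scoped Classical in
/-- The elements of the list that lie in `r`. -/
noncomputable def inside (r : Submodule ℝ V) : Finset ι := Finset.univ.filter fun i => X i ∈ r

open scoped Classical in
/-- The elements of the list that do not lie in `r`. -/
noncomputable def outside (r : Submodule ℝ V) : Finset ι := Finset.univ.filter fun i => X i ∉ r

variable {X}

@[simp]
theorem mem_inside {r : Submodule ℝ V} {i : ι} : i ∈ inside X r ↔ X i ∈ r := by simp [inside]

@[simp]
theorem mem_outside {r : Submodule ℝ V} {i : ι} : i ∈ outside X r ↔ X i ∉ r := by simp [outside]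

variable (X)

theorem derivOutside_eq (r : Submodule ℝ V) :
    derivOutside 𝕜 X r = derivProd 𝕜 X (outside X r) := rfl

/-- The Dahmen-Micchelli space of the list of those elements of `X` that lie in `r`. -/
noncomputable def dahmenMicchelli (r : Submodule ℝ V) : Submodule 𝕜 (TDist 𝕜 V) :=
  dahmenMicchelliMod 𝕜 X r ⊥ (inside X r)

variable {𝕜 X}

theorem mem_dahmenMicchelli [DecidableEq ι] {r : Submodule ℝ V} {f : TDist 𝕜 V} :
    f ∈ dahmenMicchelli 𝕜 X r ↔ f ∈ LinearMap.range (extend 𝕜 r) ∧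
      ∀ t < r, derivProd 𝕜 X (inside X r \ inside X t) f = 0 := by
  classical
  rw [dahmenMicchelli, mem_dahmenMicchelliMod]
  have h : ∀ t : Submodule ℝ V, (inside X r).filter (fun i => X i ∉ t) =
      inside X r \ inside X t := by
    intro t
    ext i
    simp
  simp only [Submodule.mem_bot, forall_eq, dirDeriv_zero, LinearMap.zero_apply, true_and, bot_le,
    forall_const, h]

theorem inside_injOn {r t : Submodule ℝ V} (hr : IsRational X r) (ht : IsRational X t)
    (h : inside X r = inside X t) : r = t := by
  have key : Set.range X ∩ r = Set.range X ∩ t := by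
    ext v
    constructor
    · rintro ⟨⟨i, rfl⟩, hi⟩
      exact ⟨⟨i, rfl⟩, mem_inside.1 (h ▸ mem_inside.2 hi)⟩
    · rintro ⟨⟨i, rfl⟩, hi⟩
      exact ⟨⟨i, rfl⟩, mem_inside.1 (h.symm ▸ mem_inside.2 hi)⟩
  rw [hr, ht, key]

instance finite_rational : Finite {r : Submodule ℝ V // IsRational X r} :=
  Finite.of_injective (fun r => inside X r.1) fun r t h => Subtype.ext (inside_injOn r.2 t.2 h)

variable (X) in
/-- The largest rational subspace of a subspace. -/
theorem exists_rational_le (t : Submodule ℝ V) :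
    ∃ t' ≤ t, IsRational X t' ∧ outside X t' = outside X t := by
  set t' := Submodule.span ℝ (Set.range X ∩ t) with ht'
  have hle : t' ≤ t := Submodule.span_le.2 Set.inter_subset_right
  have hmem : ∀ i, X i ∈ t' ↔ X i ∈ t := fun i =>
    ⟨fun h => hle h, fun h => Submodule.subset_span ⟨⟨i, rfl⟩, h⟩⟩
  refine ⟨t', hle, ?_, ?_⟩
  · have : Set.range X ∩ t' = Set.range X ∩ t := by
      ext v
      constructor
      · rintro ⟨⟨i, rfl⟩, hi⟩
        exact ⟨⟨i, rfl⟩, (hmem i).1 hi⟩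
      · rintro ⟨⟨i, rfl⟩, hi⟩
        exact ⟨⟨i, rfl⟩, (hmem i).2 hi⟩
    rw [IsRational, this]
  · ext i
    simp [hmem]

variable (X) in
-- Finitely many non-zero classes in V / r are avoided simultaneously by the kernel of some
-- functional.
theorem exists_functional [FiniteDimensional ℝ V] (r : Submodule ℝ V) :
    ∃ ℓ : V →L[ℝ] ℝ, (∀ x ∈ r, ℓ x = 0) ∧ ∀ i ∈ outside X r, ℓ (X i) ≠ 0 := by
  obtain ⟨f, hf⟩ := Module.exists_dual_forall_apply_ne_zero (K := ℝ)
    (fun i : {i // X i ∉ r} => r.mkQ (X i)) fun i h => i.2 (by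
      simpa [Submodule.Quotient.mk_eq_zero] using h)
  refine ⟨(f.comp r.mkQ).toContinuousLinearMap, fun x hx => ?_, fun i hi => ?_⟩
  · have : r.mkQ x = 0 := by simpa [Submodule.Quotient.mk_eq_zero] using hx
    simp [(Submodule.Quotient.mk_eq_zero r).2 hx]
  · exact hf ⟨i, mem_outside.1 hi⟩

/-- As r ⊓ s < r, the derivatives along X ∩ r outside s kill ∂_{X ∖ r} f. Since ∂_{X ∖ r} is
injective on one-sided distributions, they kill f itself, and they are factors of ∂_{X ∖ s}. -/
theorem derivProd_outside_eq_zero {r s : Submodule ℝ V} {ℓ : V →L[ℝ] ℝ}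
    (hℓ : ∀ i ∈ outside X r, ℓ (X i) ≠ 0) {f : TDist 𝕜 V} (hf : f ∈ halfSpaceDist 𝕜 ℓ)
    (hp : derivProd 𝕜 X (outside X r) f ∈ dahmenMicchelli 𝕜 X r) (hrs : ¬ r ≤ s) :
    derivProd 𝕜 X (outside X s) f = 0 := by
  classical
  have h1 := (mem_dahmenMicchelli.1 hp).2 (r ⊓ s) (lt_of_le_of_ne inf_le_left fun h =>
    hrs (inf_eq_left.1 h))
  refine derivProd_eq_zero_of_subset 𝕜 X (s := inside X r \ inside X (r ⊓ s)) (fun i hi => ?_) ?_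
  · simp only [Finset.mem_sdiff, mem_inside, Submodule.mem_inf, not_and] at hi
    exact mem_outside.2 (hi.2 hi.1)
  · rw [derivProd_derivProd_comm] at h1
    exact eq_zero_of_derivProd_eq_zero hℓ (derivProd_mem_halfSpaceDist _ hf) h1

/-- For r ≤ s, ∂_{X ∖ s} f is a one-sided solution of an equation with directions in s and
right-hand side on r, so it lives on s. Otherwise it is zero. -/
theorem mem_G_of_derivProd_mem {r : Submodule ℝ V} {ℓ : V →L[ℝ] ℝ} (hr : ∀ x ∈ r, ℓ x = 0)
    (hℓ : ∀ i ∈ outside X r, ℓ (X i) ≠ 0) {f : TDist 𝕜 V} (hf : f ∈ halfSpaceDist 𝕜 ℓ)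
    (hp : derivProd 𝕜 X (outside X r) f ∈ dahmenMicchelli 𝕜 X r) : f ∈ G 𝕜 X := by
  classical
  rw [mem_G]
  intro s _
  rw [derivOutside_eq]
  by_cases hrs : r ≤ s
  · have hsub : outside X s ⊆ outside X r := fun i hi =>
      mem_outside.2 fun h => mem_outside.1 hi (hrs h)
    refine mem_range_extend_of_derivProd_mem hrs hr (J := outside X r \ outside X s)
      (fun i hi => ?_) (fun i hi => hℓ i (Finset.sdiff_subset hi))
      (derivProd_mem_halfSpaceDist _ hf) ?_
    · simpa using (Finset.mem_sdiff.1 hi).2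
    · rw [← derivProd_eq_sdiff 𝕜 X hsub]
      exact (mem_dahmenMicchelli.1 hp).1
  · rw [derivProd_outside_eq_zero hℓ hf hp hrs]
    exact ⟨0, map_zero _⟩

/-- Every element `p` of a Dahmen-Micchelli space is `∂_{X ∖ r} f` for an element `f` of `𝒢(X)`
that depends linearly on `p`. -/
theorem exists_oneSided [FiniteDimensional ℝ V] (r : Submodule ℝ V) :
    ∃ L : dahmenMicchelli 𝕜 X r →ₗ[𝕜] TDist 𝕜 V, ∀ p : dahmenMicchelli 𝕜 X r,
      L p ∈ G 𝕜 X ∧ derivProd 𝕜 X (outside X r) (L p) = p ∧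
        ∀ s, ¬ r ≤ s → derivProd 𝕜 X (outside X s) (L p) = 0 := by
  classical
  obtain ⟨ℓ, hr, hℓ⟩ := exists_functional X r
  have hle : dahmenMicchelli 𝕜 X r ≤ halfSpaceDist 𝕜 ℓ := fun p hp =>
    range_extend_le_halfSpaceDist hr (mem_dahmenMicchelli.1 hp).1
  set T : halfSpaceDist 𝕜 ℓ →ₗ[𝕜] halfSpaceDist 𝕜 ℓ := (derivProd 𝕜 X (outside X r)).restrict
    fun f hf => derivProd_mem_halfSpaceDist _ hf with hT
  have hTb : Function.Bijective T := by
    constructor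
    · rw [← LinearMap.ker_eq_bot, LinearMap.ker_eq_bot']
      intro f h0
      exact Subtype.ext (eq_zero_of_derivProd_eq_zero hℓ f.2 (congr_arg Subtype.val h0))
    · intro f
      obtain ⟨h, hh, hhf⟩ := exists_derivProd_eq hℓ f.2
      exact ⟨⟨h, hh⟩, Subtype.ext hhf⟩
  set e := LinearEquiv.ofBijective T hTb with he
  have key : ∀ p : dahmenMicchelli 𝕜 X r, derivProd 𝕜 X (outside X r)
      (e.symm (Submodule.inclusion hle p) : TDist 𝕜 V) = p := fun p =>
    congr_arg Subtype.val (e.apply_symm_apply (Submodule.inclusion hle p))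
  have hmem : ∀ p : dahmenMicchelli 𝕜 X r, derivProd 𝕜 X (outside X r)
      (e.symm (Submodule.inclusion hle p) : TDist 𝕜 V) ∈ dahmenMicchelli 𝕜 X r := fun p => by
    rw [key]; exact p.2
  exact ⟨(Submodule.subtype _).comp (e.symm.toLinearMap.comp (Submodule.inclusion hle)),
    fun p => ⟨mem_G_of_derivProd_mem hr hℓ (e.symm _).2 (hmem p), key p,
      fun s hs => derivProd_outside_eq_zero hℓ (e.symm _).2 (hmem p) hs⟩⟩

/-- The factors of X ∩ r outside t combine with X ∖ r to X ∖ t, and X ∖ t is unchanged when t is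
replaced by its largest rational subspace. -/
theorem derivProd_mem_dahmenMicchelli {r : Submodule ℝ V} (hr : IsRational X r) {f : TDist 𝕜 V}
    (hf : f ∈ G 𝕜 X)
    (h0 : ∀ t < r, IsRational X t → derivProd 𝕜 X (outside X t) f = 0) :
    derivProd 𝕜 X (outside X r) f ∈ dahmenMicchelli 𝕜 X r := by
  classical
  refine mem_dahmenMicchelli.2 ⟨(mem_G 𝕜 X f).1 hf r hr, fun t ht => ?_⟩
  obtain ⟨t', ht't, ht', hout⟩ := exists_rational_le X t
  rw [← h0 t' (ht't.trans_lt ht) ht', hout, ← derivProd_union]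
  · congr 2
    ext i
    have : X i ∈ t → X i ∈ r := fun h => ht.le h
    simp only [Finset.mem_union, Finset.mem_sdiff, mem_inside, mem_outside]
    tauto
  · rw [Finset.disjoint_left]
    intro i hi hi'
    simp only [Finset.mem_sdiff, mem_inside] at hi
    exact mem_outside.1 hi' hi.1

variable (𝕜) in
/-- The space `𝒢(X)` is the direct sum of the Dahmen-Micchelli spaces of the rational subspaces. -/
theorem nonempty_linearEquiv [FiniteDimensional ℝ V]
    (hspan : Submodule.span ℝ (Set.range X) = ⊤) :
    Nonempty ((∀ r : {r : Submodule ℝ V // IsRational X r}, dahmenMicchelli 𝕜 X r.1) ≃ₗ[𝕜]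
      G 𝕜 X) := by
  classical
  have : Fintype {r : Submodule ℝ V // IsRational X r} := Fintype.ofFinite _
  choose L hLG hLr hLs using fun r : {r : Submodule ℝ V // IsRational X r} =>
    exists_oneSided (𝕜 := 𝕜) (X := X) r.1
  set Φ : (∀ r : {r : Submodule ℝ V // IsRational X r}, dahmenMicchelli 𝕜 X r.1) →ₗ[𝕜]
    TDist 𝕜 V := ∑ r, (L r).comp (LinearMap.proj r) with hΦ
  have hΦ' : ∀ p, Φ p = ∑ r, L r (p r) := fun p => by simp [hΦ]
  have hmem : ∀ p, Φ p ∈ G 𝕜 X := fun p => by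
    rw [hΦ']
    exact Submodule.sum_mem _ fun r _ => hLG r _
  -- the components of lowest dimension are read off by `∂_{X ∖ t}`
  have hlow : ∀ p (t : {r : Submodule ℝ V // IsRational X r}),
      (∀ r : {r : Submodule ℝ V // IsRational X r}, r < t → p r = 0) →
      derivProd 𝕜 X (outside X t.1) (Φ p) = p t := by
    intro p t hp
    rw [hΦ', map_sum, Finset.sum_eq_single t, hLr]
    · intro r _ hrt
      by_cases hle : r ≤ t
      · rw [hp r (lt_of_le_of_ne hle hrt), map_zero, map_zero]
      · exact hLs r _ _ hle
    · simp
  have hinj : Function.Injective Φ := by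
    rw [← LinearMap.ker_eq_bot, LinearMap.ker_eq_bot']
    intro p h0
    funext t
    induction t using WellFoundedLT.induction with
    | ind t ih =>
      have h := hlow p t fun r hr => ih r hr
      rw [h0, map_zero] at h
      exact Subtype.ext h.symm
  have hsurj : ∀ f ∈ G 𝕜 X, ∃ p, Φ p = f := by
    intro f hf
    -- Remove from f its components of dimension below n. The correction q in dimension n does not
    -- disturb what is already done, by the triangularity in `hlow`.
    have step : ∀ n : ℕ, ∃ p, ∀ t : {r : Submodule ℝ V // IsRational X r},
        Module.finrank ℝ t.1 < n → derivProd 𝕜 X (outside X t.1) (f - Φ p) = 0 := by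
      intro n
      induction n with
      | zero => exact ⟨0, by simp⟩
      | succ n ih =>
        obtain ⟨p, hp⟩ := ih
        have hg : f - Φ p ∈ G 𝕜 X := Submodule.sub_mem _ hf (hmem p)
        have hq : ∀ r : {r : Submodule ℝ V // IsRational X r}, Module.finrank ℝ r.1 = n →
            derivProd 𝕜 X (outside X r.1) (f - Φ p) ∈ dahmenMicchelli 𝕜 X r.1 := fun r hr =>
          derivProd_mem_dahmenMicchelli r.2 hg fun t ht htr => hp ⟨t, htr⟩
            (hr ▸ Submodule.finrank_lt_finrank_of_lt ht)
        set q : ∀ r : {r : Submodule ℝ V // IsRational X r}, dahmenMicchelli 𝕜 X r.1 := fun r =>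
          if h : Module.finrank ℝ r.1 = n then ⟨_, hq r h⟩ else 0 with hq'
        refine ⟨p + q, fun t ht => ?_⟩
        have hlt : ∀ r : {r : Submodule ℝ V // IsRational X r}, r < t → q r = 0 := by
          intro r hr
          have : Module.finrank ℝ r.1 < Module.finrank ℝ t.1 :=
            Submodule.finrank_lt_finrank_of_lt hr
          simp only [hq']
          rw [dif_neg (by omega)]
        rw [map_add, ← sub_sub, map_sub, hlow q t hlt]
        by_cases htn : Module.finrank ℝ t.1 = n
        · simp [hq', htn]
        · simp [hq', htn, hp t (by omega)]
    obtain ⟨p, hp⟩ := step (Module.finrank ℝ V + 1)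
    -- At ⊤ no derivative is left, so the equation reads f - Φ p = 0; here the spanning hypothesis
    -- is needed.
    have htop : IsRational X (⊤ : Submodule ℝ V) := by simp [IsRational, hspan]
    have h := hp ⟨⊤, htop⟩ (Nat.lt_succ_of_le (Submodule.finrank_le _))
    have h0 : outside X (⊤ : Submodule ℝ V) = ∅ := by ext; simp
    rw [h0] at h
    exact ⟨p, (sub_eq_zero.1 h).symm⟩
  refine ⟨LinearEquiv.ofBijective (Φ.codRestrict _ hmem) ⟨fun p q h => hinj ?_, fun f => ?_⟩⟩
  · exact congr_arg Subtype.val h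
  · obtain ⟨p, hp⟩ := hsurj f.1 f.2
    exact ⟨p, Subtype.ext hp⟩

end Decomposition

end SplineSpace

namespace SplineSpace

open MeasureTheory

/-! ### Powers of linear forms as distributions. -/

section Polynomials

theorem hasLineDerivAt_pow_succ (𝕜 : Type*) [RCLike 𝕜] {W : Type*} [NormedAddCommGroup W]
    [NormedSpace ℝ W] (k : ℕ) (ξ : W →L[ℝ] ℝ) (v x : W) :
    HasLineDerivAt ℝ (fun x => ((ξ x ^ (k + 1) / (k + 1).factorial : ℝ) : 𝕜))
      (((ξ v : ℝ) : 𝕜) * ((ξ x ^ k / k.factorial : ℝ) : 𝕜)) x v := by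
  have h1 : HasDerivAt (fun t : ℝ => ξ (x + t • v)) (ξ v) 0 := by
    simp only [map_add, map_smul, smul_eq_mul]
    simpa using ((hasDerivAt_id (0 : ℝ)).mul_const (ξ v)).const_add (ξ x)
  have h2 := (RCLike.ofRealCLM (K := 𝕜)).hasFDerivAt.comp_hasDerivAt (0 : ℝ)
    ((h1.pow (k + 1)).div_const ((k + 1).factorial : ℝ))
  refine h2.congr_deriv ?_
  rw [← RCLike.ofReal_mul]
  change ((_ : ℝ) : 𝕜) = _
  refine congr_arg _ ?_
  have h3 : (k.factorial : ℝ) ≠ 0 := by positivity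
  rw [Nat.factorial_succ]
  push_cast
  simp
  field_simp

theorem hasTemperateGrowth_pow (𝕜 : Type*) [RCLike 𝕜] {W : Type*} [NormedAddCommGroup W]
    [NormedSpace ℝ W] (k : ℕ) (ξ : W →L[ℝ] ℝ) :
    (fun x => ((ξ x ^ k / k.factorial : ℝ) : 𝕜)).HasTemperateGrowth := by
  refine (Function.RCLike.hasTemperateGrowth_ofReal (𝕜 := 𝕜)).comp ?_
  simp only [div_eq_mul_inv]
  exact (ξ.hasTemperateGrowth.pow k).mul (Function.HasTemperateGrowth.const _)

variable (𝕜 : Type*) [RCLike 𝕜] {W : Type*} [NormedAddCommGroup W] [NormedSpace ℝ W]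
  [FiniteDimensional ℝ W] [MeasurableSpace W] [BorelSpace W] (μ : Measure W) [μ.IsAddHaarMeasure]

/-- The tempered distribution with density `ξ ^ k / k!`. -/
noncomputable def powDist (k : ℕ) (ξ : W →L[ℝ] ℝ) : TDist 𝕜 W :=
  PointwiseConvergenceCLM.precomp 𝕜 (SchwartzMap.smulLeftCLM 𝕜
    fun x => ((ξ x ^ k / k.factorial : ℝ) : 𝕜))
      (ContinuousLinearMap.toPointwiseConvergenceCLM 𝕜 (RingHom.id 𝕜) 𝓢(W, 𝕜) 𝕜
        (SchwartzMap.integralCLM 𝕜 μ))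

theorem powDist_apply (k : ℕ) (ξ : W →L[ℝ] ℝ) (g : 𝓢(W, 𝕜)) :
    powDist 𝕜 μ k ξ g = ∫ x, ((ξ x ^ k / k.factorial : ℝ) : 𝕜) * g x ∂μ := by
  refine integral_congr_ae (Filter.Eventually.of_forall fun x => ?_)
  exact SchwartzMap.smulLeftCLM_apply_apply (hasTemperateGrowth_pow 𝕜 k ξ) g x

theorem integrable_pow_mul (k : ℕ) (ξ : W →L[ℝ] ℝ) (g : 𝓢(W, 𝕜)) :
    Integrable (fun x => ((ξ x ^ k / k.factorial : ℝ) : 𝕜) * g x) μ := by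
  refine ((SchwartzMap.smulLeftCLM 𝕜 (fun x => ((ξ x ^ k / k.factorial : ℝ) : 𝕜)) g).integrable
    (μ := μ)).congr (Filter.Eventually.of_forall fun x => ?_)
  exact SchwartzMap.smulLeftCLM_apply_apply (hasTemperateGrowth_pow 𝕜 k ξ) g x

theorem integral_mul_lineDerivOp {p p' : W → 𝕜} (v : W) (g : 𝓢(W, 𝕜))
    (hp : ∀ x, HasLineDerivAt ℝ p (p' x) x v) (h1 : Integrable (fun x => p' x * g x) μ)
    (h2 : Integrable (fun x => p x * (∂_{v} g : 𝓢(W, 𝕜)) x) μ)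
    (h3 : Integrable (fun x => p x * g x) μ) :
    ∫ x, p x * (∂_{v} g : 𝓢(W, 𝕜)) x ∂μ = -∫ x, p' x * g x ∂μ :=
  integral_bilinear_hasLineDerivAt_right_eq_neg_left_of_integrable
    (B := ContinuousLinearMap.mul ℝ 𝕜) h1 h2 h3 (fun x _ => hp x) fun x _ => by
      rw [SchwartzMap.lineDerivOp_apply_eq_fderiv]
      exact (g.hasFDerivAt x).hasLineDerivAt v

/-- Integration by parts; the factor 1 / k! makes ∂_v act as it does on the terms of an exponential
series. -/
theorem dirDeriv_powDist_succ (k : ℕ) (ξ : W →L[ℝ] ℝ) (v : W) :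
    dirDeriv 𝕜 v (powDist 𝕜 μ (k + 1) ξ) = ((ξ v : ℝ) : 𝕜) • powDist 𝕜 μ k ξ := by
  ext g
  change powDist 𝕜 μ (k + 1) ξ (-∂_{v} g) = ((ξ v : ℝ) : 𝕜) • powDist 𝕜 μ k ξ g
  rw [map_neg, powDist_apply, powDist_apply, integral_mul_lineDerivOp 𝕜 μ v g
    (hasLineDerivAt_pow_succ 𝕜 k ξ v) ?_ (integrable_pow_mul 𝕜 μ _ ξ _)
    (integrable_pow_mul 𝕜 μ _ ξ _), neg_neg, ← integral_smul]
  · simp only [smul_eq_mul, mul_assoc]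
  · simp only [mul_assoc]
    exact (integrable_pow_mul 𝕜 μ k ξ g).const_mul _

theorem dirDeriv_powDist_zero (ξ : W →L[ℝ] ℝ) (v : W) :
    dirDeriv 𝕜 v (powDist 𝕜 μ 0 ξ) = 0 := by
  ext g
  change powDist 𝕜 μ 0 ξ (-∂_{v} g) = 0
  rw [map_neg, powDist_apply, integral_mul_lineDerivOp 𝕜 μ v g (p' := fun _ => 0)
    (fun x => ?_) (by simp) (integrable_pow_mul 𝕜 μ _ ξ _)
    (integrable_pow_mul 𝕜 μ _ ξ _)]
  · simp
  · simp only [pow_zero]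
    exact hasDerivAt_const _ _

theorem powDist_zero (ξ : W →L[ℝ] ℝ) : powDist 𝕜 μ 0 ξ = powDist 𝕜 μ 0 0 := by
  ext g
  simp [powDist_apply]

theorem sum_powDist_eq_zero {β : Type*} [Fintype β] (k : ℕ) (ξ : β → W →L[ℝ] ℝ) (c : β → 𝕜)
    (h : ∀ x, ∑ i, c i * ((ξ i x : ℝ) : 𝕜) ^ k = 0) : ∑ i, c i • powDist 𝕜 μ k (ξ i) = 0 := by
  ext g
  have h1 : (∑ i, c i • powDist 𝕜 μ k (ξ i)) g = ∑ i, c i • powDist 𝕜 μ k (ξ i) g := by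
    simp [sum_apply]
  rw [h1]
  simp only [powDist_apply, ← integral_smul]
  have hint : ∀ i ∈ Finset.univ,
      Integrable (fun x => c i • (((ξ i x ^ k / k.factorial : ℝ) : 𝕜) * g x)) μ :=
    fun i _ => (integrable_pow_mul 𝕜 μ k (ξ i) g).smul (c i)
  rw [← integral_finsetSum _ hint]
  have h2 : ∀ x, ∑ i, c i • (((ξ i x ^ k / k.factorial : ℝ) : 𝕜) * g x) = 0 := by
    intro x
    have h3 : ∀ i, c i • (((ξ i x ^ k / k.factorial : ℝ) : 𝕜) * g x) =
        (c i * ((ξ i x : ℝ) : 𝕜) ^ k) * ((k.factorial : 𝕜)⁻¹ * g x) := by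
      intro i
      push_cast
      rw [smul_eq_mul]
      ring
    simp only [h3, ← Finset.sum_mul, h x, zero_mul]
  simp only [h2, integral_zero]
  rfl

end Polynomials

/-! ### Powers of linear forms on a subspace. -/

section Subspace

variable (𝕜 : Type*) [RCLike 𝕜] {V : Type*} [NormedAddCommGroup V] [NormedSpace ℝ V]
  [FiniteDimensional ℝ V]

/-- The densities ξ^k / k! with respect to Haar measure on r, reduced to the formal properties that
the lower bound uses. -/
theorem exists_powDist_subspace (r : Submodule ℝ V) :
    ∃ S : ℕ → (V →L[ℝ] ℝ) → TDist 𝕜 V,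
      (∀ k ξ, S k ξ ∈ LinearMap.range (extend 𝕜 r)) ∧
      (∀ k ξ, ∀ v ∈ r, dirDeriv 𝕜 v (S (k + 1) ξ) = ((ξ v : ℝ) : 𝕜) • S k ξ) ∧
      (∀ ξ, ∀ v ∈ r, dirDeriv 𝕜 v (S 0 ξ) = 0) ∧
      (∀ ξ, S 0 ξ = S 0 0) ∧ S 0 0 ≠ 0 ∧
      ∀ {β : Type} [Fintype β] (k : ℕ) (ξ : β → V →L[ℝ] ℝ) (c : β → 𝕜),
        (∀ x ∈ r, ∑ i, c i * ((ξ i x : ℝ) : 𝕜) ^ k = 0) → ∑ i, c i • S k (ξ i) = 0 := by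
  let _ : MeasurableSpace r := borel r
  have : BorelSpace r := ⟨rfl⟩
  set μ : Measure r := Measure.addHaar with hμ
  refine ⟨fun k ξ => extend 𝕜 r (powDist 𝕜 μ k (ξ.comp r.subtypeL)), fun k ξ => ⟨_, rfl⟩,
    fun k ξ v hv => ?_, fun ξ v hv => ?_, fun ξ => ?_, fun h => ?_, fun k ξ c h => ?_⟩
  · rw [dirDeriv_extend r ⟨v, hv⟩, dirDeriv_powDist_succ, map_smul]
    rfl
  · rw [dirDeriv_extend r ⟨v, hv⟩, dirDeriv_powDist_zero, map_zero]
  · simp only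
    rw [powDist_zero, powDist_zero 𝕜 μ ((0 : V →L[ℝ] ℝ).comp r.subtypeL)]
  · set b : ContDiffBump (0 : V) := ⟨1, 2, one_pos, one_lt_two⟩ with hb
    have hcs : HasCompactSupport fun x => ((b x : ℝ) : 𝕜) :=
      b.hasCompactSupport.comp_left (g := fun t : ℝ => (t : 𝕜)) (by simp)
    have hcd : ContDiff ℝ (⊤ : ℕ∞) fun x => ((b x : ℝ) : 𝕜) :=
      ContDiff.comp (g := RCLike.ofRealCLM (K := 𝕜)) (ContinuousLinearMap.contDiff _) b.contDiff
    have h1 := DFunLike.congr_fun h (hcs.toSchwartzMap hcd)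
    rw [extend_apply, powDist_apply] at h1
    have h2 : ∫ x : r, ((b (x : V) : ℝ) : 𝕜) ∂μ = 0 := by
      refine Eq.trans ?_ h1
      refine integral_congr_ae (Filter.Eventually.of_forall fun x => ?_)
      simp only [pow_zero, Nat.factorial_zero, Nat.cast_one, div_one, RCLike.ofReal_one, one_mul]
      rfl
    rw [integral_ofReal] at h2
    have h3 : ∫ x : r, b (x : V) ∂μ = 0 := by exact_mod_cast h2
    have hcont : Continuous fun x : r => b (x : V) := b.continuous.comp continuous_subtype_val
    have hcsr : HasCompactSupport fun x : r => b (x : V) :=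
      b.hasCompactSupport.comp_isClosedEmbedding
        r.closed_of_finiteDimensional.isClosedEmbedding_subtypeVal
    have h4 : 0 < ∫ x : r, b (x : V) ∂μ := by
      refine hcont.integral_pos_of_hasCompactSupport_nonneg_nonzero hcsr (fun x => b.nonneg)
        (x := 0) ?_
      have : b (0 : V) = 1 := b.one_of_mem_closedBall (by simp [b.rIn_pos.le])
      simp [this]
    exact h4.ne' h3
  · simp only [← map_smul, ← map_sum]
    rw [sum_powDist_eq_zero 𝕜 μ k (fun i => (ξ i).comp r.subtypeL) c fun x => h x x.2, map_zero]

end Subspace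

end SplineSpace

/-! ### Lower bound by initial forms of exponential sums. -/

namespace SplineSpace

/-- A filtered vector space embeds, step by step, into a space that contains the initial forms. -/
theorem finrank_le_of_filtration {K C M : Type*} [Field K] [AddCommGroup C] [Module K C]
    [FiniteDimensional K C] [AddCommGroup M] [Module K M] {D : Submodule K M}
    [FiniteDimensional K D] {F : ℕ → Submodule K C} {U : ℕ → Submodule K M} {φ : ℕ → C →ₗ[K] M}
    (hF0 : F 0 = ⊤) {N : ℕ} (hFN : F N = ⊥) (hU : Monotone U) (hUD : ∀ k, U k ≤ D)
    (hφ : ∀ k, ∀ c ∈ F k, φ k c ∈ U (k + 1)) (hker : ∀ k, ∀ c ∈ F k, φ k c = 0 → c ∈ F (k + 1))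
    (hdis : ∀ k, ∀ c ∈ F k, φ k c ∈ U k → φ k c = 0) :
    Module.finrank K C ≤ Module.finrank K D := by
  have hfin : ∀ k, FiniteDimensional K (U k) := fun k =>
    Submodule.finiteDimensional_of_le (hUD k)
  have step : ∀ k, Module.finrank K C ≤ Module.finrank K (F k) + Module.finrank K (U k) := by
    intro k
    induction k with
    | zero => rw [hF0, finrank_top]; exact Nat.le_add_right _ _
    | succ k ih =>
      -- The dimension lost from F k to F (k + 1) is at most that of A, which is independent of U k
      -- and lies in U (k + 1).
      set A := (F k).map (φ k) with hA
      have h1 : Module.finrank K (F k) ≤ Module.finrank K A + Module.finrank K (F (k + 1)) := by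
        have h2 := LinearMap.finrank_range_add_finrank_ker ((φ k).domRestrict (F k))
        rw [LinearMap.range_domRestrict, ← hA] at h2
        have h3 : Module.finrank K (LinearMap.ker ((φ k).domRestrict (F k))) ≤
            Module.finrank K (F (k + 1)) := by
          refine LinearMap.finrank_le_finrank_of_injective
            (f := ((F k).subtype.comp (Submodule.subtype _)).codRestrict (F (k + 1))
              fun c => hker k _ c.1.2 c.2) fun c d h => ?_
          have h' : (c.1.1 : C) = d.1.1 := congr_arg (fun x : F (k + 1) => (x : C)) h
          exact Subtype.ext (Subtype.ext h')
        omega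
      have h4 : A ⊓ U k = ⊥ := by
        rw [eq_bot_iff]
        rintro _ ⟨⟨c, hc, rfl⟩, hcU⟩
        exact hdis k c hc hcU
      have h5 : A ⊔ U k ≤ U (k + 1) := by
        refine sup_le ?_ (hU (Nat.le_succ k))
        rintro _ ⟨c, hc, rfl⟩
        exact hφ k c hc
      have h6 := Submodule.finrank_sup_add_finrank_inf_eq A (U k)
      rw [h4, finrank_bot] at h6
      have h7 := Submodule.finrank_mono h5
      omega
  have h := step N
  rw [hFN, finrank_bot] at h
  have := Submodule.finrank_mono (hUD N)
  omega

section LowerBound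

variable {𝕜 : Type*} [RCLike 𝕜] {V : Type*} [NormedAddCommGroup V] [NormedSpace ℝ V]
  {ι : Type*} [Fintype ι] {X : ι → V}

theorem finite_dahmenMicchelli [FiniteDimensional ℝ V] (r : Submodule ℝ V) :
    FiniteDimensional 𝕜 (dahmenMicchelli 𝕜 X r) := by
  classical
  refine Module.rank_lt_aleph0_iff.1 ?_
  exact (rank_dahmenMicchelliMod_le (fun i hi => mem_inside.1 hi) bot_le).trans_lt
    (Cardinal.natCast_lt_aleph0)

/-- The lower bound, for a module `M` with operators `d v` (the derivatives) and `P s` (their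
products), and elements `S k ξ` (the polynomials `ξ ^ k / k!`). -/
theorem card_le_finrank_of_powers {M : Type*} [AddCommGroup M] [Module 𝕜 M]
    (d : V → Module.End 𝕜 M) (P : Finset ι → Module.End 𝕜 M) [DecidableEq ι] (hP0 : P ∅ = 1)
    (hPi : ∀ i s, i ∉ s → ∀ f, P (insert i s) f = d (X i) (P s f))
    (hPc : ∀ s v f, P s (d v f) = d v (P s f)) {r : Submodule ℝ V} {β : Type} [Fintype β]
    {S : ℕ → (V →L[ℝ] ℝ) → M} {E D : Submodule 𝕜 M} [FiniteDimensional 𝕜 D]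
    (hD : ∀ f, f ∈ D ↔ f ∈ E ∧ ∀ t < r, P (inside X r \ inside X t) f = 0)
    (hSr : ∀ k ξ, S k ξ ∈ E)
    (hS1 : ∀ k ξ, ∀ v ∈ r, d v (S (k + 1) ξ) = ((ξ v : ℝ) : 𝕜) • S k ξ)
    (hS0 : ∀ ξ, ∀ v ∈ r, d v (S 0 ξ) = 0) (hSc : ∀ ξ, S 0 ξ = S 0 0) (hSne : S 0 0 ≠ 0)
    (hSsum : ∀ (k : ℕ) (ξ : β → V →L[ℝ] ℝ) (c : β → 𝕜),
      (∀ x ∈ r, ∑ i, c i * ((ξ i x : ℝ) : 𝕜) ^ k = 0) → ∑ i, c i • S k (ξ i) = 0)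
    {ξ : β → V →L[ℝ] ℝ} {v : V} (hv : v ∈ r) (hinj : Function.Injective fun B => ξ B v)
    (ν : ι → ℝ) (hξ : ∀ B, ∀ t < r, ∃ i, X i ∈ r ∧ X i ∉ t ∧ ξ B (X i) = ν i) :
    Fintype.card β ≤ Module.finrank 𝕜 D := by
  -- The coefficients c for which the exponential sum ∑ c_B exp(ξ_B) vanishes on r to order k; φ k
  -- below takes the homogeneous part of degree k.
  set F : ℕ → Submodule 𝕜 (β → 𝕜) := fun k =>
    ⨅ (j) (_ : j < k) (x) (_ : x ∈ r), LinearMap.ker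
      (∑ B, ((ξ B x : ℝ) : 𝕜) ^ j • LinearMap.proj (R := 𝕜) (φ := fun _ : β => 𝕜) B) with hF
  have memF : ∀ k c, c ∈ F k ↔ ∀ j < k, ∀ x ∈ r, ∑ B, c B * ((ξ B x : ℝ) : 𝕜) ^ j = 0 := by
    intro k c
    simp [hF, Submodule.mem_iInf, mul_comm]
  set φ : ℕ → (β → 𝕜) →ₗ[𝕜] M := fun k => Fintype.linearCombination 𝕜 fun B => S k (ξ B)
    with hφ
  have φ_apply : ∀ k c, φ k c = ∑ B, c B • S k (ξ B) := fun k c => rfl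
  have φ_zero : ∀ k j c, c ∈ F k → j < k → φ j c = 0 := fun k j c hc hj =>
    hSsum j ξ c ((memF k c).1 hc j hj)
  -- derivatives of the initial forms
  have dir_succ : ∀ k (c : β → 𝕜), ∀ x ∈ r, d x (φ (k + 1) c) =
      φ k fun B => c B * ((ξ B x : ℝ) : 𝕜) := by
    intro k c x hx
    simp only [φ_apply, map_sum, map_smul, hS1 _ _ x hx, smul_smul]
  have dir_zero : ∀ (c : β → 𝕜), ∀ x ∈ r, d x (φ 0 c) = 0 := by
    intro c x hx
    simp only [φ_apply, map_sum, map_smul, hS0 _ x hx, smul_zero, Finset.sum_const_zero]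
  have pow_apply : ∀ k (c : β → 𝕜), ∀ x ∈ r, (d x ^ k) (φ k c) =
      (∑ B, c B * ((ξ B x : ℝ) : 𝕜) ^ k) • S 0 0 := by
    intro k
    induction k with
    | zero =>
      intro c x _
      simp only [pow_zero, Module.End.one_apply, mul_one, φ_apply, hSc (ξ _), Finset.sum_smul]
    | succ k ih =>
      intro c x hx
      rw [pow_succ, Module.End.mul_apply, dir_succ k c x hx, ih _ x hx]
      congr 2
      funext B
      ring
  have pow_succ_apply : ∀ k (c : β → 𝕜), ∀ x ∈ r, (d x ^ (k + 1)) (φ k c) = 0 := by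
    intro k
    induction k with
    | zero =>
      intro c x hx
      rw [zero_add, pow_one, dir_zero c x hx]
    | succ k ih =>
      intro c x hx
      rw [pow_succ, Module.End.mul_apply, dir_succ k c x hx, ih _ x hx]
  -- Multiplying c by π s is the action of ∏ (∂_{X i} - ν_i) on the exponential sum.
  set π : Finset ι → β → 𝕜 := fun s B => ∏ i ∈ s, (((ξ B (X i) : ℝ) : 𝕜) - ((ν i : ℝ) : 𝕜)) with hπ
  have π_insert : ∀ (i : ι) (s : Finset ι), i ∉ s → ∀ c : β → 𝕜, c * π (insert i s) =
      (fun B => (c * π s) B * ((ξ B (X i) : ℝ) : 𝕜)) - ((ν i : ℝ) : 𝕜) • (c * π s) := by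
    intro i s hi c
    funext B
    simp only [hπ, Pi.mul_apply, Pi.sub_apply, Pi.smul_apply, smul_eq_mul,
      Finset.prod_insert hi]
    ring
  -- Each first-order operator lowers the order of vanishing by at most one.
  have low : ∀ k c, c ∈ F k → ∀ s : Finset ι, s ⊆ inside X r → ∀ j, s.card + j < k →
      φ j (c * π s) = 0 := by
    intro k c hc s
    induction s using Finset.induction_on with
    | empty =>
      intro _ j hj
      have h1 : c * π ∅ = c := by
        funext B
        simp [hπ]
      rw [h1]
      exact φ_zero k j c hc (by simpa using hj)
    | insert i s hi ih =>
      intro hs j hj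
      rw [Finset.card_insert_of_notMem hi] at hj
      have hs' : s ⊆ inside X r := (Finset.subset_insert i s).trans hs
      have hir : X i ∈ r := mem_inside.1 (hs (Finset.mem_insert_self i s))
      rw [π_insert i s hi, map_sub, map_smul, ih hs' j (by omega), smul_zero, sub_zero,
        ← dir_succ j _ _ hir, ih hs' (j + 1) (by omega), map_zero]
  -- In lowest degree the constants ν_i do not contribute, so ∂ and its perturbation agree on the
  -- initial form.
  have deriv_low : ∀ k c, c ∈ F k → ∀ s : Finset ι, s ⊆ inside X r → s.card ≤ k →
      P s (φ k c) = φ (k - s.card) (c * π s) := by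
    intro k c hc s
    induction s using Finset.induction_on with
    | empty =>
      intro _ _
      have h1 : c * π ∅ = c := by
        funext B
        simp [hπ]
      rw [h1, hP0, Module.End.one_apply, Finset.card_empty, Nat.sub_zero]
    | insert i s hi ih =>
      intro hs hk
      rw [Finset.card_insert_of_notMem hi] at hk ⊢
      have hs' : s ⊆ inside X r := (Finset.subset_insert i s).trans hs
      have hir : X i ∈ r := mem_inside.1 (hs (Finset.mem_insert_self i s))
      have hk' : k - s.card = (k - (s.card + 1)) + 1 := by omega
      rw [hPi i s hi, ih hs' (by omega), hk', dir_succ _ _ _ hir,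
        π_insert i s hi, map_sub, map_smul, low k c hc s hs' _ (by omega), smul_zero, sub_zero]
  have deriv_high : ∀ (s : Finset ι), s ⊆ inside X r → ∀ k < s.card, ∀ c,
      P s (φ k c) = 0 := by
    intro s
    induction s using Finset.induction_on with
    | empty => intro _ k hk; simp at hk
    | insert i s hi ih =>
      intro hs k hk c
      rw [Finset.card_insert_of_notMem hi] at hk
      have hs' : s ⊆ inside X r := (Finset.subset_insert i s).trans hs
      have hir : X i ∈ r := mem_inside.1 (hs (Finset.mem_insert_self i s))
      rw [hPi i s hi, ← hPc]
      cases k with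
      | zero => rw [dir_zero c _ hir, map_zero]
      | succ k => rw [dir_succ k c _ hir, ih hs' k (by omega)]
  have memD : ∀ k, ∀ c ∈ F k, φ k c ∈ D := by
    intro k c hc
    refine (hD _).2 ⟨Submodule.sum_mem _ fun B _ => Submodule.smul_mem _ _ (hSr _ _),
      fun t ht => ?_⟩
    rcases lt_or_ge k (inside X r \ inside X t).card with hk | hk
    · exact deriv_high _ Finset.sdiff_subset k hk c
    · rw [deriv_low k c hc _ Finset.sdiff_subset hk]
      -- The perturbed operator kills every exponential: by `hξ` each ξ_B makes one of its factors
      -- vanish.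
      have h0 : c * π (inside X r \ inside X t) = 0 := by
        funext B
        obtain ⟨i, hir, hit, hi⟩ := hξ B t ht
        have : π (inside X r \ inside X t) B = 0 :=
          Finset.prod_eq_zero (i := i) (by simp [hir, hit]) (by rw [hi, sub_self])
        simp [this]
      rw [h0, map_zero]
  -- An abstract substitute for "polynomial of degree less than k", which separates initial forms of
  -- different degrees.
  set W : ℕ → Submodule 𝕜 (M) := fun k => ⨅ (x) (_ : x ∈ r),
    LinearMap.ker (d x ^ k) with hW
  have memW : ∀ k f, f ∈ W k ↔ ∀ x ∈ r, (d x ^ k) f = 0 := by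
    intro k f
    simp only [hW, Submodule.mem_iInf, LinearMap.mem_ker]
  have hmain := finrank_le_of_filtration (K := 𝕜) (D := D) (F := F)
    (U := fun k => D ⊓ W k) (φ := φ) (N := Fintype.card β) ?_ ?_ ?_ ?_ ?_ ?_ ?_
  · rwa [Module.finrank_fintype_fun_eq_card] at hmain
  · simp [hF]
  · rw [eq_bot_iff]
    intro c hc
    set e := Fintype.equivFin β
    -- Vandermonde: the values ξ_B(v) are distinct, so as many power sums as there are points force
    -- c = 0.
    have h := Matrix.eq_zero_of_forall_pow_sum_mul_pow_eq_zero
      (f := fun i => ((ξ (e.symm i) v : ℝ) : 𝕜)) (v := fun i => c (e.symm i))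
      (fun i j hij => e.symm.injective (hinj (RCLike.ofReal_injective hij))) fun j => by
        rw [← (memF _ c).1 hc j j.2 v hv]
        exact e.symm.sum_comp fun B => c B * ((ξ B v : ℝ) : 𝕜) ^ (j : ℕ)
    refine (Submodule.mem_bot 𝕜).2 (funext fun B => ?_)
    simpa using congr_fun h (e B)
  · refine monotone_nat_of_le_succ fun k => inf_le_inf_left _ fun f hf => ?_
    rw [memW] at hf ⊢
    intro x hx
    rw [pow_succ', Module.End.mul_apply, hf x hx, map_zero]
  · exact fun k => inf_le_left
  · exact fun k c hc => ⟨memD k c hc, (memW _ _).2 fun x hx => pow_succ_apply k c x hx⟩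
  · intro k c hc h0
    rw [memF] at hc ⊢
    intro j hj x hx
    rcases Nat.lt_succ_iff_lt_or_eq.1 hj with hj | rfl
    · exact hc j hj x hx
    · have h := pow_apply j c x hx
      rw [h0, map_zero] at h
      exact (smul_eq_zero.1 h.symm).resolve_right hSne
  · intro k c _ hcU
    refine hSsum k ξ c fun x hx => ?_
    have h := pow_apply k c x hx
    rw [(memW _ _).1 hcU.2 x hx] at h
    exact (smul_eq_zero.1 h.symm).resolve_right hSne

/-- If the points `ξ B` satisfy the perturbed Dahmen-Micchelli equations and are distinct,
then the Dahmen-Micchelli space has at least their number as its dimension. -/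
theorem card_le_finrank_dahmenMicchelli [FiniteDimensional ℝ V] {r : Submodule ℝ V}
    {β : Type} [Fintype β]
    {ξ : β → V →L[ℝ] ℝ} {v : V} (hv : v ∈ r) (hinj : Function.Injective fun B => ξ B v)
    (ν : ι → ℝ) (hξ : ∀ B, ∀ t < r, ∃ i, X i ∈ r ∧ X i ∉ t ∧ ξ B (X i) = ν i) :
    Fintype.card β ≤ Module.finrank 𝕜 (dahmenMicchelli 𝕜 X r) := by
  classical
  obtain ⟨S, hSr, hS1, hS0, hSc, hSne, hSsum⟩ := exists_powDist_subspace 𝕜 r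
  have := finite_dahmenMicchelli (𝕜 := 𝕜) (X := X) r
  exact card_le_finrank_of_powers (X := X) (fun v => dirDeriv 𝕜 v) (derivProd 𝕜 X)
    (derivProd_empty 𝕜 X) (fun i s hi f => derivProd_insert_apply 𝕜 X hi f)
    (derivProd_dirDeriv 𝕜 X) (fun f => mem_dahmenMicchelli) hSr hS1 hS0 hSc hSne hSsum hv hinj ν hξ

end LowerBound

end SplineSpace

namespace SplineSpace

/-! ### Bases of rational subspaces and generic perturbations. -/

section Counting

variable {V : Type*} [NormedAddCommGroup V] [NormedSpace ℝ V] {ι : Type*} {X : ι → V}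

theorem isBasisMod_bot_iff {r : Submodule ℝ V} {S : Finset ι} :
    IsBasisMod X r ⊥ S ↔
      Submodule.span ℝ (X '' S) = r ∧ LinearIndepOn ℝ X (S : Set ι) := by
  rw [IsBasisMod, bot_sup_eq, finrank_bot, add_zero]
  refine and_congr_right fun h => ?_
  rw [LinearIndepOn, linearIndependent_iff_card_eq_finrank_span, Set.finrank,
    ← Set.image_eq_range, h]
  simp

/-- Linearly independent vectors have coordinates. -/
theorem exists_coordinates [DecidableEq ι] {S : Set ι}
    (h : LinearIndepOn ℝ X S) :
    ∃ g : V →ₗ[ℝ] ι → ℝ, ∀ i ∈ S, g (X i) = Pi.single i 1 := by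
  replace h : LinearIndependent ℝ fun i : S => X i := h
  obtain ⟨g, hg⟩ := LinearMap.exists_extend
    ((Module.Basis.span h).constr ℝ fun i : S => (Pi.single (i : ι) 1 : ι → ℝ))
  refine ⟨g, fun i hi => ?_⟩
  have := LinearMap.congr_fun hg (Module.Basis.span h ⟨i, hi⟩)
  rw [Module.Basis.constr_basis] at this
  rw [← this, LinearMap.comp_apply, Submodule.subtype_apply, Module.Basis.span_apply]

theorem isRational_span (S : Set ι) : IsRational X (Submodule.span ℝ (X '' S)) :=
  le_antisymm
    (Submodule.span_mono fun _ hv =>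
      ⟨Set.image_subset_range _ _ hv, Submodule.subset_span hv⟩)
    (Submodule.span_le.2 Set.inter_subset_right)

/-- Every linearly independent sublist is a basis of exactly one rational subspace. -/
def sigmaBasesEquiv (X : ι → V) :
    (Σ r : {r // IsRational X r}, {S : Finset ι // IsBasisMod X r.1 ⊥ S}) ≃
      {S : Finset ι // LinearIndepOn ℝ X (S : Set ι)} where
  toFun p := ⟨p.2.1, (isBasisMod_bot_iff.1 p.2.2).2⟩
  invFun S := ⟨⟨Submodule.span ℝ (X '' S.1), isRational_span _⟩, S.1,
    isBasisMod_bot_iff.2 ⟨rfl, S.2⟩⟩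
  left_inv := by
    rintro ⟨⟨r, hr⟩, S, hS⟩
    obtain ⟨rfl, -⟩ := isBasisMod_bot_iff.1 hS
    rfl
  right_inv _ := rfl

/-- A generic affine perturbation: a point of `r` and linear forms, one for each basis of `r`, that
separate at this point and take on a basis the values given by `ν`. -/
theorem exists_generic [Fintype ι] (r : Submodule ℝ V) :
    ∃ v ∈ r, ∃ (ν : ι → ℝ) (ξ : {S // IsBasisMod X r ⊥ S} → V →ₗ[ℝ] ℝ),
      Function.Injective (fun S => ξ S v) ∧ ∀ S, ∀ i ∈ S.1, ξ S (X i) = ν i := by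
  classical
  have hli := fun S : {S // IsBasisMod X r ⊥ S} => isBasisMod_bot_iff.1 S.2
  choose g hg using fun S => exists_coordinates (hli S).2
  -- All coordinates of v are non-zero in every basis S of r. Hence the support of g S v is exactly
  -- S, and distinct bases give distinct coordinate vectors.
  obtain ⟨v, hvr, hv⟩ := Module.Dual.exists_forall_mem_ne_zero_of_forall_exists r
    (fun p : Σ S : {S // IsBasisMod X r ⊥ S}, (S.1 : Finset ι) =>
      LinearMap.proj (p.2 : ι) ∘ₗ g p.1)
    (fun p => ⟨X p.2, (hli p.1).1.le (Submodule.subset_span ⟨p.2, p.2.2, rfl⟩), by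
      simp [hg p.1 p.2 p.2.2]⟩)
  have hsupp : ∀ S, ∀ j, g S v j ≠ 0 ↔ j ∈ S.1 := by
    refine fun S j => ⟨fun h => ?_, fun h => hv ⟨S, j, h⟩⟩
    by_contra hj
    refine h ?_
    have : r ≤ LinearMap.ker (LinearMap.proj j ∘ₗ g S) := by
      rw [← (hli S).1, Submodule.span_le]
      rintro _ ⟨i, hi, rfl⟩
      have hij : j ≠ i := by rintro rfl; exact hj hi
      simp [hg S i hi, hij]
    exact this hvr
  -- A form f on the coordinate space that separates these vectors. Its values on unit vectors are
  -- the ν_i, and ξ S = f ∘ g S takes the value ν_i at X i for i ∈ S.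
  obtain ⟨f, hf⟩ := Module.exists_dual_forall_apply_ne_zero (K := ℝ)
    (fun p : {p : {S // IsBasisMod X r ⊥ S} × {S // IsBasisMod X r ⊥ S} // p.1 ≠ p.2} =>
      g p.1.1 v - g p.1.2 v) (by
    rintro ⟨⟨S, T⟩, hST⟩ h
    refine hST (Subtype.ext (Finset.ext fun j => ?_))
    rw [← hsupp S, ← hsupp T, sub_eq_zero.1 h])
  refine ⟨v, hvr, fun i => f (Pi.single i 1), fun S => f ∘ₗ g S, fun S T h => ?_, fun S i hi => ?_⟩
  · by_contra hST
    refine hf ⟨(S, T), hST⟩ ?_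
    rw [map_sub]
    exact sub_eq_zero.2 h
  · rw [LinearMap.comp_apply, hg S i hi]

end Counting

/-! ### Dimension of the Dahmen-Micchelli spaces and the theorem. -/

section Dimension

variable {𝕜 : Type*} [RCLike 𝕜] {V : Type*} [NormedAddCommGroup V] [NormedSpace ℝ V]
  [FiniteDimensional ℝ V] {ι : Type} [Fintype ι] {X : ι → V}

theorem finrank_dahmenMicchelli (r : Submodule ℝ V) :
    Module.finrank 𝕜 (dahmenMicchelli 𝕜 X r) = Nat.card {S // IsBasisMod X r ⊥ S} := by
  classical
  have hsub : ∀ S, IsBasisMod X r ⊥ S → ∀ i ∈ S, X i ∈ r := fun S hS i hi =>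
    (isBasisMod_bot_iff.1 hS).1.le (Submodule.subset_span ⟨i, hi, rfl⟩)
  refine le_antisymm ?_ ?_
  · have h := rank_dahmenMicchelliMod_le (𝕜 := 𝕜) (X := X) (r := r) (U := ⊥) (s := inside X r)
      (fun i hi => mem_inside.1 hi) bot_le
    rw [Nat.card_eq_fintype_card, Fintype.card_subtype]
    refine (Module.finrank_le_of_rank_le h).trans (Finset.card_le_card ?_)
    exact Finset.filter_subset_filter _ (Finset.subset_univ _)
  · obtain ⟨v, hv, ν, ξ, hinj, hξ⟩ := exists_generic (X := X) r
    rw [Nat.card_eq_fintype_card]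
    refine card_le_finrank_dahmenMicchelli (ξ := fun S => (ξ S).toContinuousLinearMap) hv hinj ν ?_
    intro S t ht
    -- A basis of r cannot lie in a proper subspace t, so ξ S meets the perturbed equation for t.
    have : ∃ i ∈ S.1, X i ∉ t := by
      by_contra! h
      refine ht.not_ge ?_
      rw [← (isBasisMod_bot_iff.1 S.2).1, Submodule.span_le]
      rintro _ ⟨i, hi, rfl⟩
      exact h i hi
    obtain ⟨i, hi, hit⟩ := this
    exact ⟨i, hsub _ S.2 i hi, hit, hξ S i hi⟩

end Dimension

end SplineSpace

theorem mainTheorem11 {𝕜 : Type*} [RCLike 𝕜]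
    {V : Type*} [NormedAddCommGroup V] [NormedSpace ℝ V] [FiniteDimensional ℝ V]
    (Λ : Submodule ℤ V) [DiscreteTopology Λ] [IsZLattice ℝ Λ]
    {m : ℕ} (X : Fin m → V) (hmem : ∀ i, X i ∈ Λ) (hne : ∀ i, X i ≠ 0)
    (hspan : Submodule.span ℝ (Set.range X) = ⊤) :
    Module.rank 𝕜 (SplineSpace.G 𝕜 X) =
      (Nat.card {S : Finset (Fin m) // LinearIndepOn ℝ X (S : Set (Fin m))} : Cardinal) := by
  classical
  obtain ⟨e⟩ := SplineSpace.nonempty_linearEquiv 𝕜 hspan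
  have := Fintype.ofFinite {r // SplineSpace.IsRational X r}
  have (r : Submodule ℝ V) := SplineSpace.finite_dahmenMicchelli (𝕜 := 𝕜) (X := X) r
  have := Module.Finite.equiv e
  rw [← Module.finrank_eq_rank, ← e.finrank_eq, Module.finrank_pi_fintype,
    ← Nat.card_congr (SplineSpace.sigmaBasesEquiv X), Nat.card_sigma]
  simp only [SplineSpace.finrank_dahmenMicchelli]
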